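/- Let $T$ be a locally finite tree (a connected graph without cycles, identified with its vertex set) with a chosen boundary point $\omega_*\in\partial T$ (an equivalence class of semi-infinite geodesics, two of them being equivalent if they eventually coincide up to a shift). For $x\in T$ the predecessor $\mathfrak p(x)$ is the neighbour of $x$ on the semi-infinite geodesic from $x$ to $\omega_*$, and the other neighbours of $x$ form the set $\mathrm{succ}(x)$ of its successors. A flow measure on $T$ is a function $m:T\to(0,\infty)$ with $m(x)=\sum_{y\in\mathrm{succ}(x)}m(y)$ for all $x\in T$; it is identified with the discrete measure with density $m$ with respect to the counting measure, and $(T,m)$ is called a flow tree. Let $\nabla f(x)=f(x)-f(\mathfrak p(x))$ and let $\mathcal L=\frac12\nabla^*\nabla$ be the flow Laplacian, a bounded self-adjoint operator on $L^2(m)$. For a continuous function $F:\mathbb R\to\mathbb C$, the operator $F(\mathcal L)$ on $L^2(m)$ is defined by the functional calculus, and its integral kernel is $K_{F(\mathcal L)}(x,y)=\frac{1}{m(y)}\,(F(\mathcal L)\mathbf 1_{\{y\}})(x)$. **Theorem.** Let $s>3/2$. There is a constant $C_s>0$, depending only on $s$, such that the following holds for every flow tree $(T,m)$ and every $F$ in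 the Sobolev space $L^2_s(\mathbb R)$ of complex-valued functions, where $F$ is identified with its continuous representative (which exists because $s>1/2$). For every $p\in[1,\infty]$ the operator $F(\mathcal L)$ is bounded on $L^p(m)$, with $$\|F(\mathcal L)\|_{L^p(m)\to L^p(m)}\le C_s\,\|F\|_{L^2_s(\mathbb R)} .$$ Boundedness on $L^p(m)$ means that there is a bounded operator on $L^p(m)$ that agrees with $F(\mathcal L)$ on $L^2(m)\cap L^p(m)$ and is given, for every $f\in L^p(m)$ and $x\in T$, by the absolutely convergent sum $\sum_{y\in T}K_{F(\mathcal L)}(x,y)\,f(y)\,m(y)$; the displayed norm is the norm of this operator. -/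

import Mathlib

open MeasureTheory TemperedDistribution
open scoped ENNReal SchwartzMap

/-! ### Semi-infinite geodesics and the boundary at infinity of a graph -/

/-- A semi-infinite geodesic `r 0, r 1, r 2, …` in a graph: the `n`-th vertex after `r i` is at
graph distance `n` from `r i`. -/
structure GeodesicRay {V : Type*} (G : SimpleGraph V) where
  vertex : ℕ → V
  dist_vertex : ∀ i n : ℕ, G.dist (vertex i) (vertex (i + n)) = n

/-- Two semi-infinite geodesics are equivalent if, up to a shift, they eventually coincide. -/
def geodesicRaySetoid {V : Type*} (G : SimpleGraph V) : Setoid (GeodesicRay G) where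
  r a b := ∃ k l : ℕ, ∀ n : ℕ, a.vertex (k + n) = b.vertex (l + n)
  iseqv := by
    refine ⟨fun a => ⟨0, 0, fun n => rfl⟩, ?_, ?_⟩
    · rintro a b ⟨k, l, h⟩
      exact ⟨l, k, fun n => (h n).symm⟩
    · rintro a b c ⟨k, l, h⟩ ⟨k', l', h'⟩
      refine ⟨k + k', l' + l, fun n => ?_⟩
      have h1 := h (k' + n)
      have h2 := h' (l + n)
      rw [show k + k' + n = k + (k' + n) by ring, h1, show l + (k' + n) = k' + (l + n) by ring, h2,
        show l' + l + n = l' + (l + n) by ring]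

/-- The boundary at infinity of a graph (meant for trees): equivalence classes of semi-infinite
geodesics. -/
def BoundaryAtInfinity {V : Type*} (G : SimpleGraph V) : Type _ :=
  Quotient (geodesicRaySetoid G)

/-- The end point at infinity of a semi-infinite geodesic. -/
def GeodesicRay.endpoint {V : Type*} {G : SimpleGraph V} (r : GeodesicRay G) :
    BoundaryAtInfinity G :=
  Quotient.mk (geodesicRaySetoid G) r

/-! ### Trees with root at infinity -/

/-- A locally finite tree with vertex set `V`, together with a chosen boundary point, thought of as
a root at infinity. -/
structure InftyRootedTree (V : Type*) where
  graph : SimpleGraph V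
  isTree : graph.IsTree
  locallyFinite : ∀ x : V, (graph.neighborSet x).Finite
  root : BoundaryAtInfinity graph

namespace InftyRootedTree

/-- `T.Below x y` is the order relation `x ≤ y` induced by the root: `y` belongs to the
semi-infinite geodesic from `x` to the root. -/
def Below {V : Type*} (T : InftyRootedTree V) (x y : V) : Prop :=
  ∃ r : GeodesicRay T.graph, r.endpoint = T.root ∧ r.vertex 0 = x ∧ ∃ n : ℕ, r.vertex n = y

section PredecessorExists

variable {V : Type*} (T : InftyRootedTree V) (b : GeodesicRay T.graph)

theorem exists_level (x : V) :
    ∃ c : ℤ, ∃ N : ℕ, ∀ j : ℕ, N ≤ j → (T.graph.dist x (b.vertex j) : ℤ) = j - c := by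
  have hc := T.isTree.connected
  let a : ℕ → ℕ := fun j =>
    ((T.graph.dist x (b.vertex 0) : ℤ) + T.graph.dist x (b.vertex j) - j).toNat
  have ha : ∀ j, (a j : ℤ) =
      (T.graph.dist x (b.vertex 0) : ℤ) + T.graph.dist x (b.vertex j) - j := by
    intro j
    apply Int.toNat_of_nonneg
    have h1 : T.graph.dist (b.vertex 0) (b.vertex j) ≤ _ := hc.dist_triangle (v := x)
    have h2 := b.dist_vertex 0 j
    rw [zero_add] at h2
    rw [T.graph.dist_comm (u := b.vertex 0) (v := x)] at h1
    omega
  obtain ⟨N, hN⟩ : ∃ N, ∀ j, a N ≤ a j :=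
    ⟨Function.argmin a, fun j => Function.argmin_le a j⟩
  refine ⟨N - T.graph.dist x (b.vertex N), N, fun j hj => ?_⟩
  have h1 : T.graph.dist x (b.vertex j) ≤ _ := hc.dist_triangle (v := b.vertex N)
  have h2 := b.dist_vertex N (j - N)
  rw [Nat.add_sub_cancel' hj] at h2
  have h3 := hN j
  have h4 := ha j
  have h5 := ha N
  omega

/-- The level function `ℓ x = lim_j (j - d (x, b_j))` attached to a semi-infinite geodesic `b`. -/
noncomputable def levelAlong (x : V) : ℤ := (T.exists_level b x).choose

theorem levelAlong_spec (x : V) :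
    ∃ N : ℕ, ∀ j : ℕ, N ≤ j → (T.graph.dist x (b.vertex j) : ℤ) = j - T.levelAlong b x :=
  (T.exists_level b x).choose_spec

theorem levelAlong_eq {x : V} {c : ℤ} {N : ℕ}
    (h : ∀ n : ℕ, (T.graph.dist x (b.vertex (N + n)) : ℤ) = (N + n : ℕ) - c) :
    T.levelAlong b x = c := by
  obtain ⟨M, hM⟩ := T.levelAlong_spec b x
  have h1 := hM (N + M) (by omega)
  have h2 := h M
  omega

theorem levelAlong_le (x y : V) :
    T.levelAlong b y ≤ T.levelAlong b x + T.graph.dist x y := by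
  obtain ⟨M, hM⟩ := T.levelAlong_spec b x
  obtain ⟨N, hN⟩ := T.levelAlong_spec b y
  have h1 := hM (M + N) (by omega)
  have h2 := hN (M + N) (by omega)
  have h3 : T.graph.dist x (b.vertex (M + N)) ≤ _ := T.isTree.connected.dist_triangle (v := y)
  omega

theorem le_levelAlong (x : V) (j : ℕ) :
    (j : ℤ) - T.graph.dist x (b.vertex j) ≤ T.levelAlong b x := by
  obtain ⟨M, hM⟩ := T.levelAlong_spec b x
  have h1 := hM (j + M) (by omega)
  have h2 := b.dist_vertex j M
  have h3 : T.graph.dist x (b.vertex (j + M)) ≤ _ :=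
    T.isTree.connected.dist_triangle (v := b.vertex j)
  omega

theorem levelAlong_adj {x y : V} (h : T.graph.Adj x y) :
    T.levelAlong b y = T.levelAlong b x + 1 ∨ T.levelAlong b x = T.levelAlong b y + 1 := by
  obtain ⟨M, hM⟩ := T.levelAlong_spec b x
  obtain ⟨N, hN⟩ := T.levelAlong_spec b y
  have h1 := hM (M + N) (by omega)
  have h2 := hN (M + N) (by omega)
  have h3 := T.isTree.dist_eq_dist_add_one_of_adj (b.vertex (M + N)) h
  rw [T.graph.dist_comm (v := x), T.graph.dist_comm (v := y)] at h3
  omega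

theorem exists_adj_dist {x z : V} {n : ℕ} (h : T.graph.dist x z = n + 1) :
    ∃ y, T.graph.Adj x y ∧ T.graph.dist y z = n := by
  obtain ⟨w, hw⟩ := T.isTree.connected.exists_walk_length_eq_dist x z
  cases w with
  | nil =>
    rw [SimpleGraph.dist_self] at h
    omega
  | @cons _ y _ hxy w =>
    refine ⟨y, hxy, ?_⟩
    rw [SimpleGraph.Walk.length_cons] at hw
    have h1 := SimpleGraph.dist_le w
    have h2 : T.graph.dist x z ≤ _ := T.isTree.connected.dist_triangle (v := y)
    have h3 := SimpleGraph.dist_eq_one_iff_adj.2 hxy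
    omega

theorem exists_up (x : V) :
    ∃ y, T.graph.Adj x y ∧ T.levelAlong b y = T.levelAlong b x + 1 := by
  obtain ⟨M, hM⟩ := T.levelAlong_spec b x
  set j := M + (T.levelAlong b x).toNat + 1 with hj
  have h1 := hM j (by omega)
  obtain ⟨y, hy, hd⟩ := T.exists_adj_dist (x := x) (z := b.vertex j)
    (n := T.graph.dist x (b.vertex j) - 1) (by omega)
  refine ⟨y, hy, ?_⟩
  have h2 := T.le_levelAlong b y j
  have h3 := T.levelAlong_adj b hy
  omega

theorem up_unique {x y y' : V} (hy : T.graph.Adj x y) (hy' : T.graph.Adj x y')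
    (h : T.levelAlong b y = T.levelAlong b x + 1)
    (h' : T.levelAlong b y' = T.levelAlong b x + 1) : y = y' := by
  obtain ⟨M, hM⟩ := T.levelAlong_spec b x
  obtain ⟨N, hN⟩ := T.levelAlong_spec b y
  obtain ⟨N', hN'⟩ := T.levelAlong_spec b y'
  set j := M + N + N' with hj
  have h1 := hM j (by omega)
  have h2 := hN j (by omega)
  have h3 := hN' j (by omega)
  obtain ⟨w, hw⟩ := T.isTree.connected.exists_walk_length_eq_dist y (b.vertex j)
  obtain ⟨w', hw'⟩ := T.isTree.connected.exists_walk_length_eq_dist y' (b.vertex j)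
  have p : (SimpleGraph.Walk.cons hy w).IsPath := by
    apply SimpleGraph.Walk.isPath_of_length_eq_dist
    rw [SimpleGraph.Walk.length_cons]; omega
  have p' : (SimpleGraph.Walk.cons hy' w').IsPath := by
    apply SimpleGraph.Walk.isPath_of_length_eq_dist
    rw [SimpleGraph.Walk.length_cons]; omega
  have := (T.isTree.existsUnique_path x (b.vertex j)).unique p p'
  have h4 := congrArg SimpleGraph.Walk.snd this
  simpa using h4

/-- The upward neighbour of a vertex with respect to a level function. -/
noncomputable def up (x : V) : V := (T.exists_up b x).choose

theorem up_adj (x : V) : T.graph.Adj x (T.up b x) := (T.exists_up b x).choose_spec.1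

theorem levelAlong_up (x : V) : T.levelAlong b (T.up b x) = T.levelAlong b x + 1 :=
  (T.exists_up b x).choose_spec.2

theorem levelAlong_up_iterate (n : ℕ) (x : V) :
    T.levelAlong b ((T.up b)^[n] x) = T.levelAlong b x + n := by
  induction n with
  | zero => simp
  | succ n ih =>
    rw [Function.iterate_succ_apply', levelAlong_up, ih]; push_cast; ring

theorem dist_up_iterate (n : ℕ) (x : V) : T.graph.dist x ((T.up b)^[n] x) = n := by
  apply le_antisymm
  · induction n with
    | zero => simp
    | succ n ih =>
      have h1 : T.graph.dist x ((T.up b)^[n + 1] x) ≤ _ :=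
        T.isTree.connected.dist_triangle (v := (T.up b)^[n] x)
      rw [Function.iterate_succ_apply'] at h1 ⊢
      rw [SimpleGraph.dist_eq_one_iff_adj.2 (T.up_adj b ((T.up b)^[n] x))] at h1
      omega
  · have h1 := T.levelAlong_le b x ((T.up b)^[n] x)
    rw [levelAlong_up_iterate] at h1
    omega

/-- The geodesic obtained by moving upwards forever. -/
noncomputable def upRay (x : V) : GeodesicRay T.graph where
  vertex n := (T.up b)^[n] x
  dist_vertex i n := by
    rw [add_comm, Function.iterate_add_apply]
    exact T.dist_up_iterate b n _

theorem up_iterate_eq (n : ℕ) (x z : V) (h : T.graph.dist x z = n)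
    (hl : T.levelAlong b z = T.levelAlong b x + n) : (T.up b)^[n] x = z := by
  induction n generalizing x with
  | zero => simpa [T.isTree.connected.dist_eq_zero_iff] using h
  | succ n ih =>
    obtain ⟨y, hy, hd⟩ := T.exists_adj_dist h
    have h1 := T.levelAlong_le b y z
    have h2 := T.levelAlong_adj b hy
    push_cast at hl
    have h3 : T.levelAlong b y = T.levelAlong b x + 1 := by omega
    have h4 : T.up b x = y :=
      T.up_unique b (T.up_adj b x) hy (T.levelAlong_up b x) h3
    rw [Function.iterate_succ_apply, h4]
    exact ih y hd (by omega)

theorem levelAlong_vertex (j : ℕ) : T.levelAlong b (b.vertex j) = j := by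
  apply T.levelAlong_eq b (N := j)
  intro n
  rw [b.dist_vertex]; push_cast; ring

theorem upRay_endpoint (x : V) : (T.upRay b x).endpoint = b.endpoint := by
  apply Quotient.sound
  obtain ⟨M, hM⟩ := T.levelAlong_spec b x
  refine ⟨T.graph.dist x (b.vertex M), M, fun n => ?_⟩
  have h1 := hM M le_rfl
  have h2 := hM (M + n) (by omega)
  have h3 := T.levelAlong_vertex b (M + n)
  refine T.up_iterate_eq b _ x _ ?_ ?_
  · push_cast at h2; omega
  · push_cast at h2 h3 ⊢; omega

theorem levelAlong_of_below (hb : b.endpoint = T.root) {x y : V} (h : T.Below x y)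
    (hxy : T.graph.Adj x y) : T.levelAlong b y = T.levelAlong b x + 1 := by
  obtain ⟨r, hr, hx, n, hy⟩ := h
  obtain ⟨k, l, hkl⟩ : ∃ k l : ℕ, ∀ n : ℕ, r.vertex (k + n) = b.vertex (l + n) :=
    Quotient.exact (hr.trans hb.symm)
  have hlev : ∀ i ≤ k, T.levelAlong b (r.vertex i) = (l : ℤ) - k + i := by
    intro i hi
    apply T.levelAlong_eq b (N := l)
    intro m
    have h1 := r.dist_vertex i (k - i + m)
    rw [show i + (k - i + m) = k + m by omega] at h1
    rw [← hkl, h1]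
    omega
  have hlev2 : ∀ m, T.levelAlong b (r.vertex (k + m)) = (l : ℤ) + m := by
    intro m
    rw [hkl, levelAlong_vertex]; push_cast; ring
  have hall : ∀ i, T.levelAlong b (r.vertex i) = (l : ℤ) - k + i := by
    intro i
    rcases le_total i k with hi | hi
    · exact hlev i hi
    · have := hlev2 (i - k)
      rw [Nat.add_sub_cancel' hi] at this
      omega
  have hd := r.dist_vertex 0 n
  rw [zero_add, hx, hy, SimpleGraph.dist_eq_one_iff_adj.2 hxy] at hd
  have h0 := hall 0
  have hn := hall n
  rw [hx] at h0
  rw [hy] at hn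
  omega

end PredecessorExists

/-- Every vertex has exactly one neighbour lying above it. -/
theorem existsUnique_predecessor {V : Type*} (T : InftyRootedTree V) (x : V) :
    ∃! y, T.graph.Adj x y ∧ T.Below x y := by
  obtain ⟨b, hb⟩ := Quotient.exists_rep T.root
  have hb' : b.endpoint = T.root := hb
  refine ⟨T.up b x, ⟨T.up_adj b x, T.upRay b x, (T.upRay_endpoint b x).trans hb', rfl, 1, rfl⟩, ?_⟩
  rintro y ⟨hy, hxy⟩
  exact T.up_unique b hy (T.up_adj b x) (T.levelAlong_of_below b hb' hxy hy) (T.levelAlong_up b x)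

/-- The predecessor of a vertex: its unique neighbour lying above it. -/
noncomputable def pred {V : Type*} (T : InftyRootedTree V) (x : V) : V :=
  (T.existsUnique_predecessor x).choose

/-- The successors of a vertex: all its neighbours other than the predecessor. -/
def succ {V : Type*} (T : InftyRootedTree V) (x : V) : Set V :=
  {y | T.graph.Adj x y ∧ y ≠ T.pred x}

theorem finite_succ {V : Type*} (T : InftyRootedTree V) (x : V) : (T.succ x).Finite :=
  (T.locallyFinite x).subset fun _ hy => hy.1

theorem mem_succ_iff {V : Type*} (T : InftyRootedTree V) (x y : V) : y ∈ T.succ x ↔ T.pred y = x := by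
  obtain ⟨b, hb⟩ := Quotient.exists_rep T.root
  have hb' : b.endpoint = T.root := hb
  have hp : ∀ z, T.graph.Adj z (T.pred z) ∧ T.levelAlong b (T.pred z) = T.levelAlong b z + 1 := by
    intro z
    have h := (T.existsUnique_predecessor z).choose_spec.1
    exact ⟨h.1, T.levelAlong_of_below b hb' h.2 h.1⟩
  constructor
  · rintro ⟨hxy, hne⟩
    rcases T.levelAlong_adj b hxy with h | h
    · exact absurd (T.up_unique b hxy (hp x).1 h (hp x).2) hne
    · exact T.up_unique b (hp y).1 hxy.symm (hp y).2 h
  · rintro rfl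
    refine ⟨(hp y).1.symm, fun h => ?_⟩
    have h1 := (hp y).2
    have h2 := (hp (T.pred y)).2
    rw [← h] at h2
    omega

end InftyRootedTree

/-! ### Flow trees -/

theorem isSelfAdjoint_half_adjoint_comp {H : Type*} [NormedAddCommGroup H] [InnerProductSpace ℂ H]
    [CompleteSpace H] (A : H →L[ℂ] H) :
    IsSelfAdjoint ((1 / 2 : ℂ) • (ContinuousLinearMap.adjoint A ∘L A)) := by
  rw [ContinuousLinearMap.isSelfAdjoint_iff', map_smulₛₗ, ContinuousLinearMap.adjoint_comp,
    ContinuousLinearMap.adjoint_adjoint]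
  simp [map_ofNat]

/-- A flow tree: a tree with root at infinity and a flow measure `m`, i.e. a strictly positive
function whose value at each vertex is the sum of its values at the successors (a finite sum, since
the tree is locally finite). -/
structure FlowTree (V : Type*) extends InftyRootedTree V where
  m : V → ℝ
  m_pos : ∀ x, 0 < m x
  flow : ∀ x, m x = ∑ᶠ y ∈ toInftyRootedTree.succ x, m y

namespace FlowTree

/-- The flow measure as a measure on the vertex set: density `m` with respect to the counting
measure. -/
noncomputable def measure {V : Type*} [MeasurableSpace V] (T : FlowTree V) : Measure V :=
  Measure.count.withDensity fun x => ENNReal.ofReal (T.m x)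

variable {V : Type*} [MeasurableSpace V] [DiscreteMeasurableSpace V] (T : FlowTree V)

theorem lintegral_measure (f : V → ℝ≥0∞) :
    ∫⁻ x, f x ∂T.measure = ∑' x, ENNReal.ofReal (T.m x) * f x := by
  rw [measure, lintegral_withDensity_eq_lintegral_mul _ .of_discrete .of_discrete,
    lintegral_count]
  rfl

theorem measure_singleton (x : V) : T.measure {x} = ENNReal.ofReal (T.m x) := by
  rw [measure, withDensity_apply _ .of_discrete]
  simp

theorem measure_singleton_ne_top (x : V) : T.measure {x} ≠ ∞ := by
  rw [measure_singleton]
  exact ENNReal.ofReal_ne_top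

/-- The predecessor map preserves the flow measure. -/
theorem measurePreserving_pred : MeasurePreserving T.pred T.measure T.measure := by
  refine ⟨.of_discrete, ?_⟩
  ext s hs
  rw [Measure.map_apply .of_discrete hs, ← lintegral_indicator_one hs,
    ← lintegral_indicator_one (.of_discrete), lintegral_measure, lintegral_measure,
    ← (Equiv.sigmaFiberEquiv T.pred).tsum_eq, ENNReal.tsum_sigma']
  refine tsum_congr fun x => ?_
  have hfib : ∀ y : {y // T.pred y = x}, (T.pred ⁻¹' s).indicator (1 : V → ℝ≥0∞) y
      = s.indicator (1 : V → ℝ≥0∞) x := by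
    rintro ⟨y, rfl⟩
    rfl
  have hsum : ∑' y : {y // T.pred y = x}, ENNReal.ofReal (T.m y) = ENNReal.ofReal (T.m x) := by
    have hset : {y | T.pred y = x} = T.succ x := by
      ext y
      exact (T.mem_succ_iff x y).symm
    have h1 : ∑' y : {y // T.pred y = x}, ENNReal.ofReal (T.m y)
        = ∑' y : T.succ x, ENNReal.ofReal (T.m y) :=
      (Equiv.setCongr hset).tsum_eq (fun y : T.succ x => ENNReal.ofReal (T.m y))
    have hfin := T.finite_succ x
    have h2 : T.m x = ∑ y ∈ hfin.toFinset, T.m y := by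
      rw [T.flow x, finsum_mem_eq_finite_toFinset_sum _ hfin]
    rw [h1, h2, ENNReal.ofReal_sum_of_nonneg fun y _ => (T.m_pos y).le,
      ← Finset.tsum_subtype]
    exact (Equiv.setCongr (hfin.coe_toFinset)).symm.tsum_eq
      (fun y : ((hfin.toFinset : Finset V) : Set V) => ENNReal.ofReal (T.m y))
  have hstep : ∀ y : {y // T.pred y = x},
      ENNReal.ofReal (T.m (Equiv.sigmaFiberEquiv T.pred ⟨x, y⟩)) *
        (T.pred ⁻¹' s).indicator 1 (Equiv.sigmaFiberEquiv T.pred ⟨x, y⟩) =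
      ENNReal.ofReal (T.m y) * s.indicator (1 : V → ℝ≥0∞) x := by
    intro y
    rw [← hfib y]
    rfl
  rw [tsum_congr hstep, ENNReal.tsum_mul_right, hsum]

/-- The shift operator `Σ f (x) = f (𝔭 x)` on `L²(m)`, where `𝔭` is the predecessor map. -/
noncomputable def shift : Lp ℂ 2 T.measure →L[ℂ] Lp ℂ 2 T.measure :=
  (Lp.compMeasurePreservingₗᵢ ℂ T.pred T.measurePreserving_pred).toContinuousLinearMap

/-- The flow gradient `∇ f (x) = f x - f (𝔭 x)` on `L²(m)`. -/
noncomputable def gradient : Lp ℂ 2 T.measure →L[ℂ] Lp ℂ 2 T.measure :=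
  ContinuousLinearMap.id ℂ _ - T.shift

/-- The flow Laplacian `ℒ = ½ ∇* ∇` on `L²(m)`. -/
noncomputable def laplacian : Lp ℂ 2 T.measure →L[ℂ] Lp ℂ 2 T.measure :=
  (1 / 2 : ℂ) • (ContinuousLinearMap.adjoint T.gradient ∘L T.gradient)

theorem isSelfAdjoint_laplacian : IsSelfAdjoint T.laplacian :=
  isSelfAdjoint_half_adjoint_comp T.gradient

/-- The operator `F(ℒ)` on `L²(m)` for a continuous `F : ℝ → ℂ`, by the functional calculus of the
bounded self-adjoint operator `ℒ` (whose spectrum is real, so that only the values of `F` on the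
real line matter). -/
noncomputable def functionOfLaplacian (F : ℝ → ℂ) : Lp ℂ 2 T.measure →L[ℂ] Lp ℂ 2 T.measure :=
  cfc (fun z : ℂ => F z.re) T.laplacian

/-- The integral kernel, with respect to `m`, of an operator `B` on `L²(m)`:
`K_B (x, y) = (B 1_{y}) (x) / m y`. -/
noncomputable def kernel (B : Lp ℂ 2 T.measure →L[ℂ] Lp ℂ 2 T.measure) (x y : V) : ℂ :=
  B (indicatorConstLp 2 (MeasurableSet.singleton y) (T.measure_singleton_ne_top y) 1) x / T.m y

/-- The bounded operator `A` on `L^p(m)` is the realisation on `L^p(m)` of the operator `B` on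
`L²(m)`: the two agree on `L²(m) ∩ L^p(m)`, and on all of `L^p(m)` the operator `A` is given by the
(absolutely convergent) integral against the kernel of `B`. -/
structure IsRealisation (B : Lp ℂ 2 T.measure →L[ℂ] Lp ℂ 2 T.measure) {p : ℝ≥0∞} [Fact (1 ≤ p)]
    (A : Lp ℂ p T.measure →L[ℂ] Lp ℂ p T.measure) : Prop where
  agree : ∀ (f : Lp ℂ 2 T.measure) (g : Lp ℂ p T.measure), (∀ x, f x = g x) → ∀ x, B f x = A g x
  hasSum_kernel : ∀ (g : Lp ℂ p T.measure) (x : V),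
    HasSum (fun y => T.kernel B x y * g y * T.m y) (A g x)

end FlowTree

/-! ### The Sobolev norm -/

/-- The norm of the Sobolev space `L²_s(ℝ)`: the `L²` norm of the Bessel potential
`𝓕⁻¹ ((1 + ξ²)^{s/2} 𝓕 f)`. -/
noncomputable def sobolevNorm (s : ℝ) (f : 𝓢'(ℝ, ℂ)) (hf : MemSobolev s 2 f) : ℝ :=
  ‖(Classical.choose hf : Lp ℂ 2 (volume : Measure ℝ))‖

/-!
Let `Σ f (x) = f (𝔭 x)` be the shift by the predecessor map. It is an isometry because `𝔭` preserves
the flow measure, so `Σ* Σ = 1` and `ℒ = 1 - P` with `P = (Σ + Σ*) / 2`. From `Σ* Σ = 1` one gets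
`U_n(P) = ∑_{j ≤ n} Σ ^ j Σ* ^ (n - j)` for the Chebyshev polynomials of the second kind
(`FlowTree.aeval_average_U`), and `2 T_n = U_n - U_{n-2}`. The kernel of `Σ` is nonnegative with all
row and column sums equal to `1`, and such bounds are stable under sums, products, adjoints and
norm-convergent series (`FlowTree.SchurBound`); hence the row and column sums of the kernel of
`T_n(P)` are at most `1 + |n|`. By the Schur test (`FlowTree.SchurBound.exists_isRealisation`) it
therefore suffices to expand `F (1 - cos θ) = ∑ b n cos (n θ)` and to show
`∑ (1 + |n|) |b n| ≤ C ‖F‖_{L²_s}`.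

For this, let `F` be the inverse Fourier integral of `G = (1 + ξ ^ 2) ^ (-s / 2) H`, with `‖H‖₂` the
Sobolev norm. If `G` is supported in `|ξ| ≤ N`, Parseval's identity for the first two derivatives of
`F (1 - cos θ)` bounds `∑ n ^ 2 |b n| ^ 2` by `N ^ 2 ‖G‖₂ ^ 2` and `∑ n ^ 4 |b n| ^ 2` by
`N ^ 4 ‖G‖₂ ^ 2`, up to constants: each highest derivative of `F` comes with a factor `sin θ`, which
is the Jacobian of `λ = 1 - cos θ`, and the remaining term `F' (1 - cos θ) cos θ` is bounded
uniformly. Cauchy–Schwarz then gives `∑ (1 + |n|) |b n| ≲ N ^ (3 / 2) ‖G‖₂`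
(`sum_mul_norm_cosineCoeff_le_of_support`). Decomposing a general `G` into dyadic annuli, on which
`‖G‖₂ ≲ 2 ^ (-s k) ‖H‖₂`, leaves the geometric series of ratio `2 ^ (3 / 2 - s) < 1`
(`sum_mul_norm_cosineCoeff_le`).
-/

/-! ### The flow measure and integral kernels on `L²(m)` -/

open scoped InnerProductSpace ComplexConjugate

namespace FlowTree

theorem m_ne_zero {V : Type*} (T : FlowTree V) (x : V) : (T.m x : ℂ) ≠ 0 := by
  exact_mod_cast (T.m_pos x).ne'

theorem enorm_m {V : Type*} (T : FlowTree V) (x : V) :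
    ‖(T.m x : ℂ)‖ₑ = ENNReal.ofReal (T.m x) := by
  rw [← ofReal_norm, Complex.norm_real, Real.norm_of_nonneg (T.m_pos x).le]

theorem inv_enorm_m_mul {V : Type*} (T : FlowTree V) (x : V) :
    ‖(T.m x : ℂ)‖ₑ⁻¹ * ENNReal.ofReal (T.m x) = 1 := by
  rw [enorm_m]
  exact ENNReal.inv_mul_cancel (by simpa using T.m_pos x) ENNReal.ofReal_ne_top

variable {V : Type*} [MeasurableSpace V] [DiscreteMeasurableSpace V] (T : FlowTree V)

theorem measure_eq_sum_dirac :
    T.measure = Measure.sum fun y => ENNReal.ofReal (T.m y) • Measure.dirac y := by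
  ext s hs
  rw [← lintegral_indicator_one hs, lintegral_measure, Measure.sum_apply _ hs]
  refine tsum_congr fun y => ?_
  rw [Measure.smul_apply, Measure.dirac_apply' _ hs, smul_eq_mul]

theorem measure_singleton_ne_zero (x : V) : T.measure {x} ≠ 0 := by
  rw [measure_singleton]
  simpa using T.m_pos x

/-- Every vertex has positive measure, so that functions equal almost everywhere are equal. -/
theorem forall_of_ae {P : V → Prop} (h : ∀ᵐ x ∂T.measure, P x) (x : V) : P x := by
  by_contra hx
  refine T.measure_singleton_ne_zero x (measure_mono_null ?_ (ae_iff.1 h))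
  rintro _ rfl
  exact hx

theorem hasSum_integral {h : V → ℂ} (hh : Integrable h T.measure) :
    HasSum (fun y => h y * T.m y) (∫ y, h y ∂T.measure) := by
  have h1 := hh
  rw [measure_eq_sum_dirac] at h1 ⊢
  have h2 : (fun y => h y * T.m y) =
      fun y => ∫ x, h x ∂(ENNReal.ofReal (T.m y) • Measure.dirac y) := by
    funext y
    rw [integral_smul_measure, integral_dirac, ENNReal.toReal_ofReal (T.m_pos y).le,
      Complex.real_smul, mul_comm]
  rw [h2]
  exact hasSum_integral_measure h1

theorem lintegral_swap (f : V → V → ℝ≥0∞) :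
    ∫⁻ x, ∫⁻ y, f x y ∂T.measure ∂T.measure = ∫⁻ y, ∫⁻ x, f x y ∂T.measure ∂T.measure := by
  simp only [lintegral_measure, ← ENNReal.tsum_mul_left]
  rw [ENNReal.tsum_comm]
  refine tsum_congr fun y => tsum_congr fun x => ?_
  ring

/-- The indicator function of a vertex, as an element of `L²(m)`. -/
noncomputable def single (y : V) : Lp ℂ 2 T.measure :=
  indicatorConstLp 2 (MeasurableSet.singleton y) (T.measure_singleton_ne_top y) 1

theorem single_apply (y x : V) : T.single y x = ({y} : Set V).indicator (fun _ => (1 : ℂ)) x :=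
  T.forall_of_ae indicatorConstLp_coeFn x

theorem inner_single (x : V) (f : Lp ℂ 2 T.measure) : ⟪T.single x, f⟫_ℂ = f x * T.m x := by
  rw [single, L2.inner_indicatorConstLp_one, integral_singleton, Measure.real, measure_singleton,
    ENNReal.toReal_ofReal (T.m_pos x).le, Complex.real_smul, mul_comm]

theorem kernel_eq (B : Lp ℂ 2 T.measure →L[ℂ] Lp ℂ 2 T.measure) (x y : V) :
    T.kernel B x y = B (T.single y) x / T.m y := rfl

theorem kernel_eq_inner (B : Lp ℂ 2 T.measure →L[ℂ] Lp ℂ 2 T.measure) (x y : V) :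
    T.kernel B x y = ⟪T.single x, B (T.single y)⟫_ℂ / (T.m x * T.m y) := by
  have := T.m_ne_zero x
  have := T.m_ne_zero y
  rw [inner_single, kernel_eq]
  field_simp

theorem kernel_adjoint (B : Lp ℂ 2 T.measure →L[ℂ] Lp ℂ 2 T.measure) (x y : V) :
    T.kernel (ContinuousLinearMap.adjoint B) x y = conj (T.kernel B y x) := by
  rw [kernel_eq_inner, kernel_eq_inner, ContinuousLinearMap.adjoint_inner_right, map_div₀,
    inner_conj_symm, map_mul, Complex.conj_ofReal, Complex.conj_ofReal, mul_comm (T.m x : ℂ)]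

/-- On `L²(m)` every bounded operator is given by its kernel. -/
theorem hasSum_kernel_Lp_two (B : Lp ℂ 2 T.measure →L[ℂ] Lp ℂ 2 T.measure)
    (f : Lp ℂ 2 T.measure) (x : V) :
    HasSum (fun y => T.kernel B x y * f y * T.m y) (B f x) := by
  have hx := T.m_ne_zero x
  set φ := ContinuousLinearMap.adjoint B (T.single x) with hφ
  have h1 : ∀ y, conj (φ y) = T.kernel B x y * T.m x := by
    intro y
    have := T.kernel_adjoint B y x
    rw [kernel_eq, ← hφ] at this
    rw [div_eq_iff hx] at this
    rw [this, map_mul, Complex.conj_conj, Complex.conj_ofReal]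
  have h2 : ⟪φ, f⟫_ℂ = B f x * T.m x := by
    rw [hφ, ContinuousLinearMap.adjoint_inner_left, inner_single]
  have h3 := T.hasSum_integral (L2.integrable_inner (𝕜 := ℂ) φ f)
  rw [← L2.inner_def, h2] at h3
  have h4 := h3.div_const (T.m x : ℂ)
  rw [mul_div_cancel_right₀ _ hx] at h4
  have h5 : (fun y => T.kernel B x y * f y * T.m y) =
      fun y => ⟪φ y, f y⟫_ℂ * T.m y / T.m x := by
    funext y
    rw [RCLike.inner_apply', h1]
    field_simp
  rwa [h5]

/-! ### The Schur test -/

/-- The kernel of the operator `B` has row sums and column sums, with respect to the flow measure,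
at most `c`. -/
structure SchurBound (B : Lp ℂ 2 T.measure →L[ℂ] Lp ℂ 2 T.measure) (c : ℝ≥0∞) : Prop where
  row : ∀ x, ∫⁻ y, ‖T.kernel B x y‖ₑ ∂T.measure ≤ c
  col : ∀ y, ∫⁻ x, ‖T.kernel B x y‖ₑ ∂T.measure ≤ c

/-- The Schur test for nonnegative kernels (by Hölder's inequality), on `L^p(m)` for every
`p ∈ [1, ∞]`. -/
theorem eLpNorm_lintegral_kernel_le {k : V → V → ℝ≥0∞} {c : ℝ≥0∞}
    (hrow : ∀ x, ∫⁻ y, k x y ∂T.measure ≤ c) (hcol : ∀ y, ∫⁻ x, k x y ∂T.measure ≤ c)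
    {p : ℝ≥0∞} (hp : 1 ≤ p) (g : V → ℝ≥0∞) :
    eLpNorm (fun x => ∫⁻ y, k x y * g y ∂T.measure) p T.measure ≤ c * eLpNorm g p T.measure := by
  rcases eq_or_ne p ∞ with rfl | hp'
  · simp only [eLpNorm_exponent_top]
    refine essSup_le_of_ae_le _ (Filter.Eventually.of_forall fun x => ?_)
    have hg : ∀ y, g y ≤ eLpNormEssSup g T.measure :=
      T.forall_of_ae (enorm_ae_le_eLpNormEssSup g T.measure)
    calc ∫⁻ y, k x y * g y ∂T.measure
        ≤ ∫⁻ y, k x y * eLpNormEssSup g T.measure ∂T.measure := by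
          gcongr with y
          exact hg y
      _ = (∫⁻ y, k x y ∂T.measure) * eLpNormEssSup g T.measure :=
          lintegral_mul_const _ .of_discrete
      _ ≤ _ := mul_le_mul' (hrow x) (le_of_eq rfl)
  · have hp0 : p ≠ 0 := (zero_lt_one.trans_le hp).ne'
    have hr : 1 ≤ p.toReal := by
      simpa using ENNReal.toReal_mono hp' hp
    set r := p.toReal
    have hr0 : 0 < r := by linarith
    rw [eLpNorm_eq_lintegral_rpow_enorm_toReal hp0 hp',
      eLpNorm_eq_lintegral_rpow_enorm_toReal hp0 hp']
    change (∫⁻ x, (∫⁻ y, k x y * g y ∂T.measure) ^ r ∂T.measure) ^ (1 / r) ≤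
      c * (∫⁻ y, g y ^ r ∂T.measure) ^ (1 / r)
    have hx : ∀ x, (∫⁻ y, k x y * g y ∂T.measure) ^ r ≤
        c ^ (r - 1) * ∫⁻ y, k x y * g y ^ r ∂T.measure := by
      intro x
      -- Hölder's inequality for `k g = k ^ (1 - 1 / r) (k g ^ r) ^ (1 / r)`
      have h1 : ∫⁻ y, k x y * g y ∂T.measure ≤ c ^ (1 - 1 / r) *
          (∫⁻ y, k x y * g y ^ r ∂T.measure) ^ (1 / r) := by
        have h2 := ENNReal.lintegral_mul_norm_pow_le (μ := T.measure) (f := k x)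
          (g := fun y => k x y * g y ^ r) Measurable.of_discrete.aemeasurable
          Measurable.of_discrete.aemeasurable (p := 1 - 1 / r) (q := 1 / r)
          (by rw [sub_nonneg, div_le_one hr0]; exact hr) (by positivity) (by ring)
        refine le_trans (le_of_eq ?_) (h2.trans ?_)
        · refine lintegral_congr fun y => ?_
          rw [ENNReal.mul_rpow_of_nonneg _ _ (by positivity), ← ENNReal.rpow_mul,
            mul_one_div_cancel hr0.ne', ENNReal.rpow_one, ← mul_assoc,
            ← ENNReal.rpow_add_of_nonneg _ _ (by rw [sub_nonneg, div_le_one hr0]; exact hr)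
              (by positivity)]
          simp
        · refine mul_le_mul' (ENNReal.rpow_le_rpow (hrow x) ?_) le_rfl
          rw [sub_nonneg, div_le_one hr0]; exact hr
      calc (∫⁻ y, k x y * g y ∂T.measure) ^ r
          ≤ (c ^ (1 - 1 / r) * (∫⁻ y, k x y * g y ^ r ∂T.measure) ^ (1 / r)) ^ r := by
            gcongr
        _ = _ := by
            rw [ENNReal.mul_rpow_of_nonneg _ _ hr0.le, ← ENNReal.rpow_mul, ← ENNReal.rpow_mul,
              one_div_mul_cancel hr0.ne', ENNReal.rpow_one, sub_mul, one_div_mul_cancel hr0.ne',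
              one_mul]
    have h3 : ∫⁻ x, (∫⁻ y, k x y * g y ∂T.measure) ^ r ∂T.measure ≤
        c ^ r * ∫⁻ y, g y ^ r ∂T.measure := by
      calc _ ≤ ∫⁻ x, c ^ (r - 1) * ∫⁻ y, k x y * g y ^ r ∂T.measure ∂T.measure :=
            lintegral_mono hx
        _ = c ^ (r - 1) * ∫⁻ y, ∫⁻ x, k x y * g y ^ r ∂T.measure ∂T.measure := by
            rw [lintegral_const_mul _ .of_discrete, lintegral_swap]
        _ ≤ c ^ (r - 1) * ∫⁻ y, c * g y ^ r ∂T.measure := by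
            gcongr with y
            rw [lintegral_mul_const _ .of_discrete]
            gcongr
            exact hcol y
        _ = c ^ r * ∫⁻ y, g y ^ r ∂T.measure := by
            rw [lintegral_const_mul _ .of_discrete, ← mul_assoc]
            congr 1
            nth_rw 2 [← ENNReal.rpow_one c]
            rw [← ENNReal.rpow_add_of_nonneg _ _ (by linarith) zero_le_one, sub_add_cancel]
    calc _ ≤ (c ^ r * ∫⁻ y, g y ^ r ∂T.measure) ^ (1 / r) := by gcongr
      _ = _ := by
        rw [ENNReal.mul_rpow_of_nonneg _ _ (by positivity), ← ENNReal.rpow_mul,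
          mul_one_div_cancel hr0.ne', ENNReal.rpow_one]

theorem apply_lt_top_of_eLpNorm_lt_top {p : ℝ≥0∞} (hp : p ≠ 0) {N : V → ℝ≥0∞}
    (h : eLpNorm N p T.measure < ∞) (x : V) : N x < ∞ := by
  rcases eq_or_ne p ∞ with rfl | hp'
  · rw [eLpNorm_exponent_top] at h
    exact (T.forall_of_ae (enorm_ae_le_eLpNormEssSup N T.measure) x).trans_lt h
  · have h1 := lintegral_rpow_enorm_lt_top_of_eLpNorm_lt_top hp hp' h
    have h2 := T.forall_of_ae (ae_lt_top .of_discrete h1.ne) x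
    simpa [ENNReal.rpow_lt_top_iff_of_pos (ENNReal.toReal_pos hp hp')] using h2

variable {T}

/-- The Schur test for operators: a Schur bound on `L²(m)` yields realisations on all `L^p(m)`. -/
theorem SchurBound.exists_isRealisation {B : Lp ℂ 2 T.measure →L[ℂ] Lp ℂ 2 T.measure} {c : ℝ}
    (hc : 0 ≤ c) (hB : T.SchurBound B (ENNReal.ofReal c)) (p : ℝ≥0∞) [hp : Fact (1 ≤ p)] :
    ∃ A : Lp ℂ p T.measure →L[ℂ] Lp ℂ p T.measure, T.IsRealisation B A ∧ ‖A‖ ≤ c := by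
  have key : ∀ g : Lp ℂ p T.measure,
      eLpNorm (fun x => ∫⁻ y, ‖T.kernel B x y‖ₑ * ‖g y‖ₑ ∂T.measure) p T.measure ≤
        ENNReal.ofReal c * eLpNorm g p T.measure := by
    intro g
    have := T.eLpNorm_lintegral_kernel_le hB.row hB.col hp.out fun y => ‖g y‖ₑ
    rwa [eLpNorm_enorm] at this
  have hfin : ∀ (g : Lp ℂ p T.measure) (x : V),
      ∫⁻ y, ‖T.kernel B x y‖ₑ * ‖g y‖ₑ ∂T.measure < ∞ := fun g =>
    T.apply_lt_top_of_eLpNorm_lt_top (zero_lt_one.trans_le hp.out).ne'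
      ((key g).trans_lt (ENNReal.mul_lt_top ENNReal.ofReal_lt_top (Lp.eLpNorm_lt_top g)))
  have henorm : ∀ (g : Lp ℂ p T.measure) (x y : V), ‖T.kernel B x y * g y * T.m y‖ₑ =
      ENNReal.ofReal (T.m y) * (‖T.kernel B x y‖ₑ * ‖g y‖ₑ) := by
    intro g x y
    rw [enorm_mul, enorm_mul, mul_comm, enorm_m]
  have hsum : ∀ (g : Lp ℂ p T.measure) (x : V),
      Summable fun y => T.kernel B x y * g y * T.m y := by
    intro g x
    refine Summable.of_enorm ?_
    have := (hfin g x).ne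
    rw [lintegral_measure] at this
    simpa only [henorm] using this
  have hle : ∀ (g : Lp ℂ p T.measure),
      eLpNorm (fun x => ∑' y, T.kernel B x y * g y * T.m y) p T.measure ≤
        ENNReal.ofReal c * eLpNorm g p T.measure := by
    intro g
    refine (eLpNorm_mono_enorm fun x => ?_).trans (key g)
    refine enorm_tsum_le_tsum_enorm.trans ?_
    rw [enorm_eq_self, lintegral_measure]
    simp only [henorm, le_refl]
  have hmem : ∀ (g : Lp ℂ p T.measure),
      MemLp (fun x => ∑' y, T.kernel B x y * g y * T.m y) p T.measure := fun g =>
    ⟨Measurable.of_discrete.aestronglyMeasurable,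
      (hle g).trans_lt (ENNReal.mul_lt_top ENNReal.ofReal_lt_top (Lp.eLpNorm_lt_top g))⟩
  have hcoe : ∀ (g : Lp ℂ p T.measure) (x : V),
      (hmem g).toLp _ x = ∑' y, T.kernel B x y * g y * T.m y := fun g =>
    T.forall_of_ae (hmem g).coeFn_toLp
  let A₀ : Lp ℂ p T.measure →ₗ[ℂ] Lp ℂ p T.measure :=
    { toFun := fun g => (hmem g).toLp _
      map_add' := by
        intro g h
        refine Lp.ext (Filter.Eventually.of_forall fun x => ?_)
        rw [T.forall_of_ae (Lp.coeFn_add _ _) x, Pi.add_apply, hcoe, hcoe, hcoe,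
          ← (hsum g x).tsum_add (hsum h x)]
        refine tsum_congr fun y => ?_
        rw [T.forall_of_ae (Lp.coeFn_add g h) y, Pi.add_apply]
        ring
      map_smul' := by
        intro a g
        refine Lp.ext (Filter.Eventually.of_forall fun x => ?_)
        rw [RingHom.id_apply, T.forall_of_ae (Lp.coeFn_smul _ _) x, Pi.smul_apply, hcoe, hcoe,
          smul_eq_mul, ← tsum_mul_left]
        refine tsum_congr fun y => ?_
        rw [T.forall_of_ae (Lp.coeFn_smul a g) y, Pi.smul_apply, smul_eq_mul]
        ring }
  have hA₀ : ∀ g, ‖A₀ g‖ ≤ c * ‖g‖ := by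
    intro g
    have h1 := ENNReal.toReal_mono (ENNReal.mul_lt_top ENNReal.ofReal_lt_top
      (Lp.eLpNorm_lt_top g)).ne (hle g)
    rw [ENNReal.toReal_mul, ENNReal.toReal_ofReal hc] at h1
    rwa [← Lp.norm_def, ← Lp.norm_toLp _ (hmem g)] at h1
  refine ⟨A₀.mkContinuous c hA₀, ⟨fun f g hfg x => ?_, fun g x => ?_⟩,
    A₀.mkContinuous_norm_le hc hA₀⟩
  · refine ((T.hasSum_kernel_Lp_two B f x).tsum_eq.symm.trans ?_).trans (hcoe g x).symm
    simp only [hfg]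
  · rw [LinearMap.mkContinuous_apply]
    change HasSum _ ((hmem g).toLp _ x)
    rw [hcoe]
    exact (hsum g x).hasSum

end FlowTree

/-! ### The algebra of operators with a Schur bound -/

theorem summable_of_sum_one_add_abs_mul_le {b : ℤ → ℂ} {c : ℝ}
    (hb : ∀ s : Finset ℤ, ∑ n ∈ s, (1 + |(n : ℝ)|) * ‖b n‖ ≤ c) : Summable b := by
  refine Summable.of_norm (summable_of_sum_le (fun n => norm_nonneg _) (c := c) fun s => ?_)
  refine (Finset.sum_le_sum fun n _ => ?_).trans (hb s)
  nlinarith [mul_nonneg (abs_nonneg (n : ℝ)) (norm_nonneg (b n))]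

namespace FlowTree

variable {V : Type*} [MeasurableSpace V] [DiscreteMeasurableSpace V] {T : FlowTree V}

theorem shift_apply (f : Lp ℂ 2 T.measure) (x : V) : T.shift f x = f (T.pred x) :=
  T.forall_of_ae (Lp.coeFn_compMeasurePreserving f T.measurePreserving_pred) x

theorem lintegral_mul_indicator_singleton (a : ℝ≥0∞) (x : V) :
    ∫⁻ y, a * ({x} : Set V).indicator 1 y ∂T.measure = a * ENNReal.ofReal (T.m x) := by
  rw [lintegral_const_mul _ .of_discrete, lintegral_indicator_one (MeasurableSet.singleton x),
    measure_singleton]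

theorem enorm_single_div (x y z : V) :
    ‖T.single y z / (T.m x : ℂ)‖ₑ = ‖(T.m x : ℂ)‖ₑ⁻¹ * ({y} : Set V).indicator 1 z := by
  rw [div_eq_inv_mul, enorm_mul, enorm_inv (T.m_ne_zero x), single_apply]
  by_cases h : z = y <;> simp [h]

namespace SchurBound

theorem one : T.SchurBound 1 1 where
  row x := by
    have h : ∀ y, ‖T.kernel 1 x y‖ₑ = ‖(T.m x : ℂ)‖ₑ⁻¹ * ({x} : Set V).indicator 1 y := by
      intro y
      rw [kernel_eq, one_apply_eq_self, enorm_single_div]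
      by_cases h : x = y
      · simp [h]
      · simp [h, Ne.symm h]
    simp only [h]
    rw [lintegral_mul_indicator_singleton, inv_enorm_m_mul]
  col y := by
    simp only [kernel_eq, one_apply_eq_self, enorm_single_div]
    rw [lintegral_mul_indicator_singleton, inv_enorm_m_mul]

theorem shift : T.SchurBound T.shift 1 where
  row x := by
    have h : ∀ y, ‖T.kernel T.shift x y‖ₑ =
        ‖(T.m (T.pred x) : ℂ)‖ₑ⁻¹ * ({T.pred x} : Set V).indicator 1 y := by
      intro y
      rw [kernel_eq, shift_apply, enorm_single_div]
      by_cases h : T.pred x = y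
      · simp [h]
      · simp [h, Ne.symm h]
    simp only [h]
    rw [lintegral_mul_indicator_singleton, inv_enorm_m_mul]
  col y := by
    simp only [kernel_eq, shift_apply, enorm_single_div]
    -- the predecessor map preserves the flow measure
    rw [T.measurePreserving_pred.lintegral_comp (f := fun z =>
      ‖(T.m y : ℂ)‖ₑ⁻¹ * ({y} : Set V).indicator 1 z) .of_discrete,
      lintegral_mul_indicator_singleton, inv_enorm_m_mul]

variable {A B : Lp ℂ 2 T.measure →L[ℂ] Lp ℂ 2 T.measure} {a b : ℝ≥0∞}

theorem adjoint (hA : T.SchurBound A a) :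
    T.SchurBound (ContinuousLinearMap.adjoint A) a where
  row x := by simpa only [kernel_adjoint, RCLike.enorm_conj] using hA.col x
  col y := by simpa only [kernel_adjoint, RCLike.enorm_conj] using hA.row y

theorem add (hA : T.SchurBound A a) (hB : T.SchurBound B b) : T.SchurBound (A + B) (a + b) := by
  have h : ∀ x y, ‖T.kernel (A + B) x y‖ₑ ≤ ‖T.kernel A x y‖ₑ + ‖T.kernel B x y‖ₑ := by
    intro x y
    refine le_trans (le_of_eq ?_) (enorm_add_le _ _)
    rw [kernel_eq, kernel_eq, kernel_eq, _root_.add_apply,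
      T.forall_of_ae (Lp.coeFn_add _ _) x, Pi.add_apply, add_div]
  refine ⟨fun x => ?_, fun y => ?_⟩
  · refine (lintegral_mono (h x)).trans ?_
    rw [lintegral_add_left .of_discrete]
    exact add_le_add (hA.row x) (hB.row x)
  · refine (lintegral_mono fun x => h x y).trans ?_
    rw [lintegral_add_left .of_discrete]
    exact add_le_add (hA.col y) (hB.col y)

theorem smul (hA : T.SchurBound A a) (z : ℂ) : T.SchurBound (z • A) (‖z‖ₑ * a) := by
  have h : ∀ x y, ‖T.kernel (z • A) x y‖ₑ = ‖z‖ₑ * ‖T.kernel A x y‖ₑ := by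
    intro x y
    rw [← enorm_mul, kernel_eq, kernel_eq, _root_.smul_apply,
      T.forall_of_ae (Lp.coeFn_smul _ _) x, Pi.smul_apply, smul_eq_mul, mul_div_assoc]
  refine ⟨fun x => ?_, fun y => ?_⟩
  · simp only [h]
    rw [lintegral_const_mul _ .of_discrete]
    gcongr
    exact hA.row x
  · simp only [h]
    rw [lintegral_const_mul _ .of_discrete]
    gcongr
    exact hA.col y

theorem enorm_kernel_mul_le (A B : Lp ℂ 2 T.measure →L[ℂ] Lp ℂ 2 T.measure) (x z : V) :
    ‖T.kernel (A * B) x z‖ₑ ≤ ∫⁻ y, ‖T.kernel A x y‖ₑ * ‖T.kernel B y z‖ₑ ∂T.measure := by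
  have h1 := (T.hasSum_kernel_Lp_two A (B (T.single z)) x).div_const (T.m z : ℂ)
  have h2 : T.kernel (A * B) x z =
      ∑' y, T.kernel A x y * B (T.single z) y * T.m y / T.m z := by
    rw [h1.tsum_eq, kernel_eq]
    rfl
  rw [h2]
  refine enorm_tsum_le_tsum_enorm.trans (le_of_eq ?_)
  rw [lintegral_measure]
  refine tsum_congr fun y => ?_
  have h3 : T.kernel A x y * B (T.single z) y * T.m y / T.m z =
      (T.m y : ℂ) * (T.kernel A x y * T.kernel B y z) := by
    rw [T.kernel_eq B]
    ring
  rw [h3, enorm_mul, enorm_mul, enorm_m]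

theorem mul (hA : T.SchurBound A a) (hB : T.SchurBound B b) : T.SchurBound (A * B) (a * b) where
  row x := by
    refine (lintegral_mono fun z => enorm_kernel_mul_le A B x z).trans ?_
    rw [lintegral_swap]
    calc _ = ∫⁻ y, ‖T.kernel A x y‖ₑ * ∫⁻ z, ‖T.kernel B y z‖ₑ ∂T.measure ∂T.measure :=
          lintegral_congr fun y => lintegral_const_mul _ .of_discrete
      _ ≤ ∫⁻ y, ‖T.kernel A x y‖ₑ * b ∂T.measure := by
          gcongr with y
          exact hB.row y
      _ = (∫⁻ y, ‖T.kernel A x y‖ₑ ∂T.measure) * b := lintegral_mul_const _ .of_discrete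
      _ ≤ a * b := mul_le_mul' (hA.row x) le_rfl
  col z := by
    refine (lintegral_mono fun x => enorm_kernel_mul_le A B x z).trans ?_
    rw [lintegral_swap]
    calc _ = ∫⁻ y, (∫⁻ x, ‖T.kernel A x y‖ₑ ∂T.measure) * ‖T.kernel B y z‖ₑ ∂T.measure :=
          lintegral_congr fun y => lintegral_mul_const _ .of_discrete
      _ ≤ ∫⁻ y, a * ‖T.kernel B y z‖ₑ ∂T.measure :=
          lintegral_mono fun y => mul_le_mul' (hA.col y) le_rfl
      _ = a * ∫⁻ y, ‖T.kernel B y z‖ₑ ∂T.measure := lintegral_const_mul _ .of_discrete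
      _ ≤ a * b := mul_le_mul' le_rfl (hB.col z)

theorem mono (hA : T.SchurBound A a) (hab : a ≤ b) : T.SchurBound A b :=
  ⟨fun x => (hA.row x).trans hab, fun y => (hA.col y).trans hab⟩

theorem zero : T.SchurBound 0 0 := by
  simpa using (one (T := T)).smul 0

theorem sum {ι : Type*} {s : Finset ι} {A : ι → Lp ℂ 2 T.measure →L[ℂ] Lp ℂ 2 T.measure}
    {c : ι → ℝ≥0∞} (h : ∀ i ∈ s, T.SchurBound (A i) (c i)) :
    T.SchurBound (∑ i ∈ s, A i) (∑ i ∈ s, c i) := by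
  classical
  induction s using Finset.induction_on with
  | empty => simpa using zero
  | insert i s hi ih =>
    rw [Finset.sum_insert hi, Finset.sum_insert hi]
    exact (h i (Finset.mem_insert_self i s)).add
      (ih fun j hj => h j (Finset.mem_insert_of_mem hj))

theorem pow (hA : T.SchurBound A a) (n : ℕ) : T.SchurBound (A ^ n) (a ^ n) := by
  induction n with
  | zero => simpa using one
  | succ n ih =>
    rw [pow_succ, pow_succ]
    exact ih.mul hA

/-- Schur bounds pass to sums of series that converge in operator norm. -/
theorem of_hasSum {ι : Type*} {A : ι → Lp ℂ 2 T.measure →L[ℂ] Lp ℂ 2 T.measure}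
    {B : Lp ℂ 2 T.measure →L[ℂ] Lp ℂ 2 T.measure} {c : ι → ℝ≥0∞}
    (hAB : HasSum A B) (h : ∀ i, T.SchurBound (A i) (c i)) : T.SchurBound B (∑' i, c i) := by
  have hk : ∀ x y, ‖T.kernel B x y‖ₑ ≤ ∑' i, ‖T.kernel (A i) x y‖ₑ := by
    intro x y
    have h1 : HasSum (fun i => T.kernel (A i) x y) (T.kernel B x y) := by
      simp only [kernel_eq_inner]
      refine HasSum.div_const ?_ _
      exact ((innerSL ℂ (T.single x)).hasSum
        ((ContinuousLinearMap.apply ℂ (Lp ℂ 2 T.measure) (T.single y)).hasSum hAB))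
    rw [← h1.tsum_eq]
    exact enorm_tsum_le_tsum_enorm
  have hswap : ∀ f : V → ι → ℝ≥0∞,
      ∫⁻ y, ∑' i, f y i ∂T.measure = ∑' i, ∫⁻ y, f y i ∂T.measure := by
    intro f
    simp only [lintegral_measure, ← ENNReal.tsum_mul_left]
    rw [ENNReal.tsum_comm]
  refine ⟨fun x => ?_, fun y => ?_⟩
  · refine (lintegral_mono (hk x)).trans ?_
    rw [hswap]
    exact ENNReal.tsum_le_tsum fun i => (h i).row x
  · refine (lintegral_mono fun x => hk x y).trans ?_
    rw [hswap]
    exact ENNReal.tsum_le_tsum fun i => (h i).col y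

end SchurBound

/-! ### Chebyshev polynomials of the averaging operator -/

variable (T)

/-- The averaging operator `(Σ + Σ*) / 2`, where `Σ` is the shift. -/
noncomputable def average : Lp ℂ 2 T.measure →L[ℂ] Lp ℂ 2 T.measure :=
  (1 / 2 : ℂ) • (T.shift + ContinuousLinearMap.adjoint T.shift)

theorem adjoint_shift_mul_shift : ContinuousLinearMap.adjoint T.shift * T.shift = 1 :=
  ContinuousLinearMap.norm_map_iff_adjoint_comp_self _ |>.1
    fun f => Lp.norm_compMeasurePreserving f T.measurePreserving_pred

theorem laplacian_eq : T.laplacian = 1 - T.average := by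
  have h := T.adjoint_shift_mul_shift
  have h1 : ContinuousLinearMap.adjoint T.gradient = 1 - ContinuousLinearMap.adjoint T.shift := by
    rw [gradient, map_sub]
    congr 1
    exact ContinuousLinearMap.adjoint_id
  have h2 : ContinuousLinearMap.adjoint T.gradient * T.gradient =
      (2 : ℂ) • 1 - (T.shift + ContinuousLinearMap.adjoint T.shift) := by
    rw [h1]
    change (1 - ContinuousLinearMap.adjoint T.shift) * (1 - T.shift) = _
    rw [sub_mul, mul_sub, mul_sub, h, mul_one, one_mul, mul_one, two_smul]
    abel
  change (1 / 2 : ℂ) • (ContinuousLinearMap.adjoint T.gradient * T.gradient) = _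
  rw [h2, smul_sub, smul_smul, average]
  norm_num

theorem norm_average_le_one : ‖T.average‖ ≤ 1 := by
  have h : ‖T.shift‖ ≤ 1 := LinearIsometry.norm_toContinuousLinearMap_le _
  calc ‖T.average‖ ≤ ‖(1 / 2 : ℂ)‖ * ‖T.shift + ContinuousLinearMap.adjoint T.shift‖ :=
        (norm_smul (1 / 2 : ℂ) (T.shift + ContinuousLinearMap.adjoint T.shift)).le
    _ ≤ (1 / 2) * (1 + 1) := by
        have h2 : ‖ContinuousLinearMap.adjoint T.shift‖ ≤ 1 := by
          rwa [LinearIsometryEquiv.norm_map]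
        have := (norm_add_le T.shift (ContinuousLinearMap.adjoint T.shift)).trans (add_le_add h h2)
        have h3 : ‖(1 / 2 : ℂ)‖ = 1 / 2 := by norm_num
        rw [h3]
        gcongr
    _ = 1 := by norm_num

open Polynomial in
/-- Since `Σ* Σ = 1`, the Chebyshev polynomials of the second kind of `(Σ + Σ*) / 2` are sums of
the operators `Σ ^ j Σ* ^ k`. -/
theorem aeval_average_U (n : ℕ) : aeval T.average (Chebyshev.U ℂ n) =
    ∑ j ∈ Finset.range (n + 1),
      T.shift ^ j * (ContinuousLinearMap.adjoint T.shift) ^ (n - j) := by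
  set S := T.shift
  set R := ContinuousLinearMap.adjoint T.shift
  have hRS : R * S = 1 := T.adjoint_shift_mul_shift
  have h2 : 2 * T.average = S + R := by
    rw [average, mul_smul_comm, two_mul, ← two_smul ℂ, smul_smul]
    norm_num [S, R]
  induction n using Nat.twoStepInduction with
  | zero => simp
  | one =>
    rw [Nat.cast_one, Chebyshev.U_one, map_mul, map_ofNat, aeval_X, h2]
    simp [Finset.sum_range_succ, add_comm]
  | more n ih0 ih1 =>
    have hU := Chebyshev.U_add_two ℂ n
    rw [show ((n + 2 : ℕ) : ℤ) = (n : ℤ) + 2 by push_cast; ring, hU, map_sub, map_mul, map_mul,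
      aeval_X, map_ofNat, h2, ih0]
    rw [show ((n : ℤ) + 1) = ((n + 1 : ℕ) : ℤ) by push_cast; ring, ih1, add_mul, Finset.mul_sum,
      Finset.mul_sum]
    -- multiplication by `Σ` gives the terms with a positive power of `Σ`
    have e1 : ∑ j ∈ Finset.range (n + 2), S * (S ^ j * R ^ (n + 1 - j)) =
        ∑ j ∈ Finset.range (n + 2), S ^ (j + 1) * R ^ (n + 2 - (j + 1)) := by
      refine Finset.sum_congr rfl fun j hj => ?_
      rw [← mul_assoc, ← pow_succ', show n + 2 - (j + 1) = n + 1 - j by omega]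
    -- multiplication by `Σ*` gives the remaining term and the sum for `n`
    have e2 : ∑ j ∈ Finset.range (n + 2), R * (S ^ j * R ^ (n + 1 - j)) =
        ∑ j ∈ Finset.range (n + 1), S ^ j * R ^ (n - j) + R ^ (n + 2) := by
      rw [Finset.sum_range_succ']
      congr 1
      · refine Finset.sum_congr rfl fun j hj => ?_
        rw [pow_succ', ← mul_assoc, ← mul_assoc, hRS, one_mul,
          show n + 1 - (j + 1) = n - j by omega]
      · simp [pow_succ']
    rw [show n + 1 + 1 = n + 2 from rfl, e1, e2, show n + 2 + 1 = (n + 2) + 1 from rfl,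
      Finset.sum_range_succ' (fun j => S ^ j * R ^ (n + 2 - j))]
    simp only [pow_zero, one_mul, Nat.sub_zero]
    abel

open Polynomial in
theorem schurBound_aeval_U (n : ℕ) :
    T.SchurBound (aeval T.average (Chebyshev.U ℂ n)) (n + 1) := by
  rw [aeval_average_U]
  have h : ∀ j ∈ Finset.range (n + 1), T.SchurBound
      (T.shift ^ j * (ContinuousLinearMap.adjoint T.shift) ^ (n - j)) 1 := by
    intro j _
    simpa using (SchurBound.shift.pow j).mul (SchurBound.shift.adjoint.pow (n - j))
  simpa using SchurBound.sum h

open Polynomial in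
theorem schurBound_aeval_T (n : ℤ) :
    T.SchurBound (aeval T.average (Chebyshev.T ℂ n)) (1 + n.natAbs) := by
  have hhalf : ‖(1 / 2 : ℂ)‖ₑ = 2⁻¹ := by
    rw [one_div, enorm_inv two_ne_zero]
    simp [← ofReal_norm]
  have htwo : (2⁻¹ : ℝ≥0∞) * 2 = 1 := ENNReal.inv_mul_cancel two_ne_zero ENNReal.ofNat_ne_top
  rw [← Chebyshev.T_natAbs]
  generalize n.natAbs = k
  match k with
  | 0 => simpa using SchurBound.one
  | 1 =>
    rw [Nat.cast_one, Chebyshev.T_one, aeval_X]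
    refine ((SchurBound.shift.add SchurBound.shift.adjoint).smul (1 / 2)).mono ?_
    rw [hhalf, one_add_one_eq_two, htwo]
    exact le_self_add
  | k + 2 =>
    have h := ((T.schurBound_aeval_U (k + 2)).smul (1 / 2)).add
      ((T.schurBound_aeval_U k).smul (-(1 / 2)))
    have h1 : aeval T.average (Chebyshev.T ℂ (k + 2 : ℕ)) =
        (1 / 2 : ℂ) • aeval T.average (Chebyshev.U ℂ (k + 2 : ℕ)) +
          (-(1 / 2) : ℂ) • aeval T.average (Chebyshev.U ℂ k) := by
      have h2 := congrArg (aeval T.average) (Chebyshev.two_mul_T_eq_U_sub_U ℂ k)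
      rw [map_mul, map_sub, map_ofNat] at h2
      push_cast
      rw [neg_smul, ← sub_eq_add_neg, ← smul_sub, ← h2, two_mul, ← two_smul ℂ, smul_smul]
      norm_num
    rw [h1]
    refine h.mono ?_
    rw [enorm_neg, hhalf, ← mul_add]
    calc (2⁻¹ : ℝ≥0∞) * (((k + 2 : ℕ) : ℝ≥0∞) + 1 + (k + 1)) = 2⁻¹ * 2 * (k + 2) := by
          push_cast
          ring
      _ ≤ 1 + ((k + 2 : ℕ) : ℝ≥0∞) := by
          rw [htwo, one_mul]
          push_cast
          exact le_add_self

/-! ### Functions of the Laplacian as Chebyshev series -/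

/-- The spectrum of the Laplacian is contained in `[0, 2]`, i.e. in the range of `1 - cos`. -/
theorem exists_cos_of_mem_spectrum {z : ℂ} (hz : z ∈ spectrum ℂ T.laplacian) :
    ∃ θ : ℝ, z = ((1 - Real.cos θ : ℝ) : ℂ) := by
  have hre : z = z.re := T.isSelfAdjoint_laplacian.mem_spectrum_eq_re hz
  have h1 : 1 - z ∈ spectrum ℂ T.average := by
    have h2 : T.average = algebraMap ℂ _ 1 - T.laplacian := by
      rw [laplacian_eq, map_one]
      abel
    rw [h2, ← spectrum.singleton_sub_eq]
    exact ⟨1, rfl, z, hz, rfl⟩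
  have h2 : ‖1 - z‖ ≤ 1 := by
    refine (spectrum.norm_le_norm_mul_of_mem h1).trans ?_
    refine (mul_le_mul T.norm_average_le_one ?_ (norm_nonneg _) zero_le_one).trans_eq (one_mul 1)
    exact ContinuousLinearMap.norm_id_le
  have h3 : |1 - z.re| ≤ 1 := by
    refine le_trans ?_ h2
    simpa using Complex.abs_re_le_norm (1 - z)
  refine ⟨Real.arccos (1 - z.re), ?_⟩
  rw [Real.cos_arccos (abs_le.1 h3).1 (abs_le.1 h3).2, sub_sub_cancel]
  exact hre

open Polynomial in
/-- If `F (1 - cos θ)` has an absolutely convergent cosine series `∑ b n cos (n θ)`, then `F(ℒ)` is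
the sum of the Chebyshev series `∑ b n T_n((Σ + Σ*) / 2)`. -/
theorem hasSum_functionOfLaplacian {F : ℝ → ℂ} {b : ℤ → ℂ} (hb : Summable b)
    (hF : ∀ θ : ℝ, HasSum (fun n => b n * Complex.cos (n * θ)) (F (1 - Real.cos θ))) :
    HasSum (fun n => b n • aeval T.average (Chebyshev.T ℂ n)) (T.functionOfLaplacian F) := by
  have : IsStarNormal T.laplacian := T.isSelfAdjoint_laplacian.isStarNormal
  -- a polynomial in `1 - z` that takes the value `T_n (1 - z)`
  let q : ℤ → ℂ[X] := fun n => C (b n) * (Chebyshev.T ℂ n).comp (1 - X)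
  have hq : ∀ (n : ℤ) (θ : ℝ), (q n).eval ((1 - Real.cos θ : ℝ) : ℂ) =
      b n * Complex.cos (n * θ) := by
    intro n θ
    simp only [q, eval_mul, eval_C, eval_comp, eval_sub, eval_one, eval_X]
    rw [Complex.ofReal_sub, Complex.ofReal_one, sub_sub_cancel, Complex.ofReal_cos,
      Chebyshev.T_complex_cos]
  have hqa : ∀ n, aeval T.laplacian (q n) = b n • aeval T.average (Chebyshev.T ℂ n) := by
    intro n
    simp only [q, map_mul, aeval_C, aeval_comp, map_sub, map_one, aeval_X]
    rw [laplacian_eq, sub_sub_cancel, Algebra.smul_def]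
  have hlim := tendsto_cfc_fun (R := ℂ) (a := T.laplacian) (l := Filter.atTop)
    (F := fun s : Finset ℤ => fun z => (∑ n ∈ s, q n).eval z) (f := fun z => F z.re) ?_ ?_
  · have h1 : ∀ s : Finset ℤ, cfc (fun z => (∑ n ∈ s, q n).eval z) T.laplacian =
        ∑ n ∈ s, b n • aeval T.average (Chebyshev.T ℂ n) := by
      intro s
      rw [cfc_polynomial _ T.laplacian, map_sum]
      exact Finset.sum_congr rfl fun n _ => hqa n
    simp only [h1] at hlim
    exact hlim
  · have hu := tendstoUniformlyOn_tsum (f := fun n z => (q n).eval z) hb.norm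
      (s := spectrum ℂ T.laplacian) ?_
    · refine (hu.congr ?_).congr_right ?_
      · exact Filter.Eventually.of_forall fun s z _ => (eval_finsetSum s q z).symm
      · intro z hz
        obtain ⟨θ, rfl⟩ := T.exists_cos_of_mem_spectrum hz
        simp only [hq]
        rw [(hF θ).tsum_eq, Complex.ofReal_re]
    · intro n z hz
      obtain ⟨θ, rfl⟩ := T.exists_cos_of_mem_spectrum hz
      rw [hq, norm_mul]
      refine mul_le_of_le_one_right (norm_nonneg _) ?_
      rw [show (n : ℂ) * θ = ((n * θ : ℝ) : ℂ) by push_cast; rfl, ← Complex.ofReal_cos,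
        Complex.norm_real]
      exact Real.abs_cos_le_one _
  · exact Filter.Eventually.of_forall fun s => (∑ n ∈ s, q n).continuous.continuousOn

open Polynomial in
/-- A cosine series of `F (1 - cos θ)` with `∑ (1 + |n|) |b n| < ∞` bounds `F(ℒ)` on all `L^p(m)`:
the factor `1 + |n|` is the norm of `T_n((Σ + Σ*) / 2)`. -/
theorem exists_isRealisation_of_cosine_series {F : ℝ → ℂ} {b : ℤ → ℂ} {c : ℝ} (hc : 0 ≤ c)
    (hb : ∀ s : Finset ℤ, ∑ n ∈ s, (1 + |(n : ℝ)|) * ‖b n‖ ≤ c)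
    (hF : ∀ θ : ℝ, HasSum (fun n => b n * Complex.cos (n * θ)) (F (1 - Real.cos θ)))
    (p : ℝ≥0∞) [Fact (1 ≤ p)] :
    ∃ A : Lp ℂ p T.measure →L[ℂ] Lp ℂ p T.measure,
      T.IsRealisation (T.functionOfLaplacian F) A ∧ ‖A‖ ≤ c := by
  have hnn : ∀ n : ℤ, 0 ≤ (1 + |(n : ℝ)|) * ‖b n‖ := fun n => by positivity
  have h1 := SchurBound.of_hasSum
    (T.hasSum_functionOfLaplacian (summable_of_sum_one_add_abs_mul_le hb) hF)
    fun n => (T.schurBound_aeval_T n).smul (b n)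
  refine SchurBound.exists_isRealisation hc (h1.mono ?_) p
  have h2 : ∀ n : ℤ, ‖b n‖ₑ * (1 + (n.natAbs : ℝ≥0∞)) =
      ENNReal.ofReal ((1 + |(n : ℝ)|) * ‖b n‖) := by
    intro n
    rw [ENNReal.ofReal_mul (by positivity), ENNReal.ofReal_add zero_le_one (abs_nonneg _),
      ENNReal.ofReal_one, ofReal_norm, mul_comm, ← Int.cast_abs, Int.abs_eq_natAbs,
      Int.cast_natCast, ENNReal.ofReal_natCast]
  simp only [h2]
  refine ENNReal.summable.tsum_le_of_sum_le fun s => ?_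
  rw [← ENNReal.ofReal_sum_of_nonneg fun n _ => hnn n]
  exact ENNReal.ofReal_le_ofReal (hb s)

end FlowTree

/-! ### The Fourier transform on `L¹(ℝ) ∩ L²(ℝ)` -/

open FourierTransform

/-- On `L¹ ∩ L²` the inverse Fourier transform of `L²` is given by the Fourier integral. -/
theorem coeFn_fourierInv_of_integrable (f : Lp ℂ 2 (volume : Measure ℝ)) (hf : Integrable f) :
    (𝓕⁻ f : Lp ℂ 2 (volume : Measure ℝ)) =ᵐ[volume] 𝓕⁻ (f : ℝ → ℂ) := by
  have hcont : Continuous (𝓕⁻ (f : ℝ → ℂ)) := by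
    have : 𝓕⁻ (f : ℝ → ℂ) = fun x => 𝓕 (f : ℝ → ℂ) (-x) := by
      funext x
      exact Real.fourierInv_eq_fourier_neg _ x
    rw [this]
    exact (VectorFourier.fourierIntegral_continuous Real.continuous_fourierChar
      (L := innerₗ ℝ) continuous_inner hf).comp continuous_neg
  refine ae_eq_of_integral_contDiff_smul_eq
    ((Lp.memLp _).locallyIntegrable one_le_two) hcont.locallyIntegrable fun ψ hψ hψc => ?_
  have h1 : HasCompactSupport (Complex.ofRealCLM ∘ ψ) := hψc.comp_left rfl
  have h2 : ContDiff ℝ ((⊤ : ℕ∞) : WithTop ℕ∞) (Complex.ofRealCLM ∘ ψ) := by fun_prop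
  let η : 𝓢(ℝ, ℂ) := h1.toSchwartzMap h2
  have hη : ∀ x, η x = ψ x := fun x => rfl
  have h3 := congrArg (fun u : 𝓢'(ℝ, ℂ) => u η) (Lp.fourierInv_toTemperedDistribution_eq f)
  simp only [TemperedDistribution.fourierInv_apply, Lp.toTemperedDistribution_apply] at h3
  have h4 : ∫ x, ψ x • (𝓕⁻ f : Lp ℂ 2 (volume : Measure ℝ)) x =
      ∫ x, η x • (𝓕⁻ f : Lp ℂ 2 (volume : Measure ℝ)) x :=
    integral_congr_ae (Filter.Eventually.of_forall fun x => by simp [hη])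
  have h5 : ∫ x, ψ x • 𝓕⁻ (f : ℝ → ℂ) x = ∫ x, η x • 𝓕⁻ (f : ℝ → ℂ) x :=
    integral_congr_ae (Filter.Eventually.of_forall fun x => by simp [hη])
  rw [h4, h5, ← h3]
  have h6 := VectorFourier.integral_fourierIntegral_smul_eq_flip (L := -innerₗ ℝ)
    (μ := (volume : Measure ℝ)) (ν := (volume : Measure ℝ)) (f := η) (g := f)
    Real.continuous_fourierChar (continuous_inner (𝕜 := ℝ) (E := ℝ)).neg η.integrable hf
  have h7 : (-innerₗ ℝ : ℝ →ₗ[ℝ] ℝ →ₗ[ℝ] ℝ).flip = -innerₗ ℝ := by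
    ext
    simp
  rw [h7] at h6
  rw [SchwartzMap.fourierInv_coe]
  exact h6

/-- Plancherel's theorem for the Fourier integral of a function in `L¹ ∩ L²`. -/
theorem integrable_and_integral_norm_sq_fourier {g : ℝ → ℂ} (h1 : Integrable g)
    (h2 : MemLp g 2 volume) :
    Integrable (fun x => ‖𝓕 g x‖ ^ 2) ∧ ∫ x, ‖𝓕 g x‖ ^ 2 = ∫ x, ‖g x‖ ^ 2 := by
  set f : Lp ℂ 2 (volume : Measure ℝ) := h2.toLp g with hf
  have hfg : f =ᵐ[volume] g := h2.coeFn_toLp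
  have h3 : (𝓕⁻ f : Lp ℂ 2 (volume : Measure ℝ)) =ᵐ[volume] 𝓕⁻ g := by
    refine (coeFn_fourierInv_of_integrable f (h1.congr hfg.symm)).trans ?_
    exact Filter.Eventually.of_forall fun x => Real.fourierInv_congr_ae hfg x
  have h4 : MemLp (𝓕⁻ g) 2 volume := (memLp_congr_ae h3).1 (Lp.memLp _)
  have hnorm : ∀ u : Lp ℂ 2 (volume : Measure ℝ), ∫ x, ‖u x‖ ^ 2 = ‖u‖ ^ 2 := by
    intro u
    have := congrArg RCLike.re (L2.inner_def (𝕜 := ℂ) u u)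
    rw [← integral_re (L2.integrable_inner u u), inner_self_eq_norm_sq] at this
    simpa only [inner_self_eq_norm_sq] using this.symm
  have h5 : ∫ x, ‖𝓕⁻ g x‖ ^ 2 = ∫ x, ‖g x‖ ^ 2 := by
    calc ∫ x, ‖𝓕⁻ g x‖ ^ 2 = ∫ x, ‖(𝓕⁻ f : Lp ℂ 2 (volume : Measure ℝ)) x‖ ^ 2 :=
          integral_congr_ae (h3.mono fun x hx => by simp only [hx])
      _ = ∫ x, ‖f x‖ ^ 2 := by
          rw [hnorm, hnorm]
          congr 1
          exact (Lp.fourierTransformₗᵢ ℝ ℂ).symm.norm_map f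
      _ = _ := integral_congr_ae (hfg.mono fun x hx => by simp only [hx])
  have h6 : (fun x => ‖𝓕 g x‖ ^ 2) = fun x => ‖𝓕⁻ g (-x)‖ ^ 2 := by
    funext x
    rw [Real.fourierInv_eq_fourier_neg, neg_neg]
  rw [h6]
  refine ⟨?_, ?_⟩
  · exact (h4.integrable_norm_pow two_ne_zero).comp_neg
  · rw [integral_neg_eq_self (fun x => ‖𝓕⁻ g x‖ ^ 2), h5]

/-- The Cauchy–Schwarz inequality for a function supported in `[-N, N]`. -/
theorem sq_integral_norm_le_of_support {g : ℝ → ℂ} {N : ℝ} (hN : 0 < N)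
    (hg : MemLp g 2 volume) (hsupp : ∀ ξ, N < |ξ| → g ξ = 0) :
    Integrable g ∧ (∫ ξ, ‖g ξ‖) ^ 2 ≤ 2 * N * ∫ ξ, ‖g ξ‖ ^ 2 := by
  have hs : Function.support g ⊆ Set.Icc (-N) N := by
    intro ξ hξ
    by_contra h
    exact hξ (hsupp ξ (by rwa [Set.mem_Icc, ← abs_le, not_le] at h))
  have h1 : IntegrableOn g (Set.Icc (-N) N) :=
    (hg.restrict _).integrable one_le_two
  have h2 : Integrable g := (integrableOn_iff_integrable_of_support_subset hs).1 h1
  have h3 : Integrable fun ξ => ‖g ξ‖ ^ 2 := hg.integrable_norm_pow two_ne_zero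
  refine ⟨h2, ?_⟩
  have e1 : ∫ ξ, ‖g ξ‖ = ∫ ξ in Set.Icc (-N) N, ‖g ξ‖ := by
    refine (setIntegral_eq_integral_of_forall_compl_eq_zero fun ξ hξ => ?_).symm
    rw [Function.notMem_support.1 fun h => hξ (hs h), norm_zero]
  have e2 : ∫ ξ, ‖g ξ‖ ^ 2 = ∫ ξ in Set.Icc (-N) N, ‖g ξ‖ ^ 2 := by
    refine (setIntegral_eq_integral_of_forall_compl_eq_zero fun ξ hξ => ?_).symm
    rw [Function.notMem_support.1 fun h => hξ (hs h), norm_zero, zero_pow two_ne_zero]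
  set a := ∫ ξ, ‖g ξ‖
  -- integrate `(‖g‖ - t) ^ 2 ≥ 0`, where `t` is the mean value of `‖g‖`
  have h4 : 0 ≤ ∫ ξ in Set.Icc (-N) N,
      (‖g ξ‖ ^ 2 - 2 * (a / (2 * N)) * ‖g ξ‖ + (a / (2 * N)) ^ 2) :=
    integral_nonneg fun ξ => by
      have := sq_nonneg (‖g ξ‖ - a / (2 * N))
      simp only [Pi.zero_apply]
      nlinarith
  have h7 : IntegrableOn (fun ξ => ‖g ξ‖ ^ 2 - 2 * (a / (2 * N)) * ‖g ξ‖) (Set.Icc (-N) N) :=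
    h3.integrableOn.sub (h1.norm.const_mul _)
  rw [integral_add h7 (by simp), integral_sub h3.integrableOn (h1.norm.const_mul _),
    integral_const_mul, ← e1, ← e2,
    setIntegral_const] at h4
  have hvol : (volume : Measure ℝ).real (Set.Icc (-N) N) = 2 * N := by
    rw [Measure.real, Real.volume_Icc, ENNReal.toReal_ofReal (by linarith)]
    ring
  rw [hvol, smul_eq_mul] at h4
  have h5 : 2 * (a / (2 * N)) * a - 2 * N * (a / (2 * N)) ^ 2 = a ^ 2 / (2 * N) := by
    field_simp
    ring
  have h6 : a ^ 2 / (2 * N) ≤ ∫ ξ, ‖g ξ‖ ^ 2 := by linarith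
  rwa [div_le_iff₀ (by positivity), mul_comm] at h6

theorem norm_fourier_le (g : ℝ → ℂ) (x : ℝ) : ‖𝓕 g x‖ ≤ ∫ ξ, ‖g ξ‖ :=
  VectorFourier.norm_fourierIntegral_le_integral_norm _ _ _ _ _

theorem continuous_fourier_of_integrable {g : ℝ → ℂ} (hg : Integrable g) : Continuous (𝓕 g) :=
  VectorFourier.fourierIntegral_continuous Real.continuous_fourierChar
    (L := innerₗ ℝ) continuous_inner hg

/-- The function whose Fourier integral is the derivative of the Fourier integral of `g`. -/
noncomputable def mulFreq (g : ℝ → ℂ) (ξ : ℝ) : ℂ := (-2 * Real.pi * Complex.I * ξ) • g ξ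

theorem norm_mulFreq_le {g : ℝ → ℂ} {N : ℝ} (hsupp : ∀ ξ, N < |ξ| → g ξ = 0) (ξ : ℝ) :
    ‖mulFreq g ξ‖ ≤ 2 * Real.pi * N * ‖g ξ‖ := by
  rcases lt_or_ge N |ξ| with h | h
  · simp [mulFreq, hsupp ξ h]
  · rw [mulFreq, norm_smul]
    gcongr
    simp only [norm_mul, norm_neg, Complex.norm_I, Complex.norm_real, Real.norm_eq_abs,
      abs_of_pos Real.pi_pos, mul_one]
    simpa using mul_le_mul_of_nonneg_left h (by positivity)

theorem mulFreq_eq_zero {g : ℝ → ℂ} {N : ℝ} (hsupp : ∀ ξ, N < |ξ| → g ξ = 0) (ξ : ℝ)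
    (h : N < |ξ|) : mulFreq g ξ = 0 := by
  simp [mulFreq, hsupp ξ h]

theorem memLp_mulFreq {g : ℝ → ℂ} {N : ℝ} (hg : MemLp g 2 volume)
    (hsupp : ∀ ξ, N < |ξ| → g ξ = 0) : MemLp (mulFreq g) 2 volume := by
  refine hg.of_le_mul (c := 2 * Real.pi * N) ?_
    (Filter.Eventually.of_forall (norm_mulFreq_le hsupp))
  refine AEStronglyMeasurable.smul (f := fun ξ : ℝ => (-2 * Real.pi * Complex.I * ξ : ℂ)) ?_ hg.1
  exact Continuous.aestronglyMeasurable (by fun_prop)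

theorem integral_norm_sq_mulFreq_le {g : ℝ → ℂ} {N : ℝ} (hg : MemLp g 2 volume)
    (hsupp : ∀ ξ, N < |ξ| → g ξ = 0) :
    ∫ ξ, ‖mulFreq g ξ‖ ^ 2 ≤ (2 * Real.pi * N) ^ 2 * ∫ ξ, ‖g ξ‖ ^ 2 := by
  rw [← integral_const_mul]
  refine integral_mono ((memLp_mulFreq hg hsupp).integrable_norm_pow two_ne_zero)
    ((hg.integrable_norm_pow two_ne_zero).const_mul _) fun ξ => ?_
  simp only
  rw [← mul_pow]
  gcongr
  exact norm_mulFreq_le hsupp ξ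

theorem hasDerivAt_fourier_mulFreq {g : ℝ → ℂ} {N : ℝ} (hN : 0 < N) (hg : MemLp g 2 volume)
    (hsupp : ∀ ξ, N < |ξ| → g ξ = 0) (x : ℝ) : HasDerivAt (𝓕 g) (𝓕 (mulFreq g) x) x := by
  refine Real.hasDerivAt_fourier (sq_integral_norm_le_of_support hN hg hsupp).1 ?_ x
  have h := (sq_integral_norm_le_of_support hN (memLp_mulFreq hg hsupp) (mulFreq_eq_zero hsupp)).1
  refine (h.const_mul ((-2 * Real.pi * Complex.I : ℂ)⁻¹)).congr
    (Filter.Eventually.of_forall fun ξ => ?_)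
  have hpi : (Real.pi : ℂ) ≠ 0 := by exact_mod_cast Real.pi_ne_zero
  simp only [mulFreq, smul_eq_mul, Complex.real_smul]
  field_simp

/-! ### Fourier coefficients of `θ ↦ 𝓕 g (cos θ - 1)` -/

theorem abs_mul_norm_fourierCoeffOn_le {f f' : ℝ → ℂ} (hf : ∀ x, HasDerivAt f (f' x) x)
    (hf' : Continuous f') (hper : f (2 * Real.pi) = f 0) (n : ℤ) :
    |(n : ℝ)| * ‖fourierCoeffOn Real.two_pi_pos f n‖ ≤ ‖fourierCoeffOn Real.two_pi_pos f' n‖ := by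
  rcases eq_or_ne n 0 with rfl | hn
  · simp
  have hn' : (n : ℂ) ≠ 0 := by exact_mod_cast hn
  have hpi : (Real.pi : ℂ) ≠ 0 := by exact_mod_cast Real.pi_ne_zero
  have h := fourierCoeffOn_of_hasDerivAt Real.two_pi_pos hn (fun x _ => hf x)
    (hf'.intervalIntegrable _ _)
  have h2 : (n : ℂ) * fourierCoeffOn Real.two_pi_pos f n =
      -Complex.I * fourierCoeffOn Real.two_pi_pos f' n := by
    rw [h, hper, sub_self, mul_zero, zero_sub]
    push_cast
    field_simp
    rw [Complex.I_sq]
    ring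
  have h3 := congrArg norm h2
  rw [norm_mul, norm_mul, norm_neg, Complex.norm_I, one_mul, Complex.norm_intCast] at h3
  exact h3.le

theorem sum_sq_fourierCoeffOn_le {f : ℝ → ℂ} (hf : Continuous f) (s : Finset ℤ) :
    ∑ n ∈ s, ‖fourierCoeffOn Real.two_pi_pos f n‖ ^ 2 ≤
      (2 * Real.pi)⁻¹ * ∫ θ in (0)..(2 * Real.pi), ‖f θ‖ ^ 2 := by
  have h := hasSum_sq_fourierCoeffOn Real.two_pi_pos (f := f) ?_
  · rw [sub_zero, smul_eq_mul] at h
    exact sum_le_hasSum s (fun n _ => by positivity) h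
  · obtain ⟨c, hc⟩ := isCompact_Icc.exists_bound_of_continuousOn
      (s := Set.Icc 0 (2 * Real.pi)) hf.continuousOn
    refine MemLp.of_bound hf.aestronglyMeasurable c ?_
    filter_upwards [ae_restrict_mem measurableSet_Ioc] with x hx
    exact hc x (Set.Ioc_subset_Icc_self hx)

/-- The change of variables `x = cos θ - 1`, whose Jacobian is `|sin θ|`; each `x ∈ (-2, 0)` is
attained twice. -/
theorem integral_comp_cos_sub_one_le {f : ℝ → ℝ} (hf : Continuous f) (hf0 : ∀ x, 0 ≤ f x)
    (hi : Integrable f) :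
    ∫ θ in (0)..(2 * Real.pi), |Real.sin θ| * f (Real.cos θ - 1) ≤ 2 * ∫ x, f x := by
  have hpi := Real.pi_pos
  have hle : ∫ x in (-2)..(0), f x ≤ ∫ x, f x := by
    rw [intervalIntegral.integral_of_le (by norm_num)]
    exact setIntegral_le_integral hi (Filter.Eventually.of_forall hf0)
  have hd : ∀ x : ℝ, HasDerivAt (fun θ => Real.cos θ - 1) (-Real.sin x) x := fun x =>
    (Real.hasDerivAt_cos x).sub_const 1
  have hc : Continuous fun θ => |Real.sin θ| * f (Real.cos θ - 1) := by fun_prop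
  have e1 : ∫ θ in (0)..Real.pi, |Real.sin θ| * f (Real.cos θ - 1) = ∫ x in (-2)..(0), f x := by
    have h := intervalIntegral.integral_comp_mul_deriv (a := 0) (b := Real.pi) (g := f)
      (fun x _ => hd x) (by fun_prop) hf
    rw [Real.cos_pi, Real.cos_zero, sub_self, show (-1 - 1 : ℝ) = -2 by norm_num] at h
    rw [intervalIntegral.integral_symm 0 (-2), ← h, ← intervalIntegral.integral_neg]
    refine intervalIntegral.integral_congr fun θ hθ => ?_
    rw [Set.uIcc_of_le hpi.le] at hθ
    simp only [Function.comp_apply]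
    rw [abs_of_nonneg (Real.sin_nonneg_of_nonneg_of_le_pi hθ.1 hθ.2)]
    ring
  have e2 : ∫ θ in Real.pi..(2 * Real.pi), |Real.sin θ| * f (Real.cos θ - 1) =
      ∫ x in (-2)..(0), f x := by
    have h := intervalIntegral.integral_comp_mul_deriv (a := Real.pi) (b := 2 * Real.pi) (g := f)
      (fun x _ => hd x) (by fun_prop) hf
    rw [Real.cos_pi, Real.cos_two_pi, sub_self, show (-1 - 1 : ℝ) = -2 by norm_num] at h
    rw [← h]
    refine intervalIntegral.integral_congr fun θ hθ => ?_
    rw [Set.uIcc_of_le (by linarith)] at hθ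
    have : Real.sin θ ≤ 0 := by
      rw [← Real.sin_sub_two_pi]
      exact Real.sin_nonpos_of_nonpos_of_neg_pi_le (by linarith [hθ.2]) (by linarith [hθ.1])
    simp only [Function.comp_apply]
    rw [abs_of_nonpos this]
    ring
  rw [← intervalIntegral.integral_add_adjacent_intervals (b := Real.pi)
    (hc.intervalIntegrable _ _) (hc.intervalIntegrable _ _), e1, e2]
  linarith

/-- Comparison with the telescoping series of `1 / (M + n - 1/2) - 1 / (M + n + 1/2)`. -/
theorem sum_inv_sq_add_sq_le {M : ℝ} (hM : 1 ≤ M) (s : Finset ℤ) :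
    ∑ n ∈ s, (M ^ 2 + (n : ℝ) ^ 2)⁻¹ ≤ 8 / M := by
  have hpos : 0 < M := by linarith
  have hterm : ∀ k : ℕ, (M ^ 2 + (k : ℝ) ^ 2)⁻¹ ≤
      2 * (M + k - 1 / 2)⁻¹ - 2 * (M + (k + 1 : ℕ) - 1 / 2)⁻¹ := by
    intro k
    have hk : (0 : ℝ) ≤ k := k.cast_nonneg
    have h1 : 0 < M + k - 1 / 2 := by linarith
    have h2 : M + (k + 1 : ℕ) - 1 / 2 = (M + k - 1 / 2) + 1 := by push_cast; ring
    have h3 : M ^ 2 + (k : ℝ) ^ 2 ≥ ((M + k - 1 / 2) * (M + k - 1 / 2 + 1)) / 2 := by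
      nlinarith [sq_nonneg (M - k)]
    rw [h2]
    set a := M + k - 1 / 2
    have h4 : 2 * a⁻¹ - 2 * (a + 1)⁻¹ = (a * (a + 1) / 2)⁻¹ := by
      field_simp
      ring
    rw [h4]
    exact inv_anti₀ (by positivity) h3
  have hrange : ∀ K : ℕ, ∑ k ∈ Finset.range K, (M ^ 2 + (k : ℝ) ^ 2)⁻¹ ≤ 4 / M := by
    intro K
    refine (Finset.sum_le_sum fun k _ => hterm k).trans ?_
    rw [Finset.sum_range_sub' (fun k : ℕ => 2 * (M + k - 1 / 2)⁻¹)]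
    have h1 : 0 < M + K - 1 / 2 := by
      have : (0 : ℝ) ≤ K := K.cast_nonneg
      linarith
    have h2 : (M - 1 / 2)⁻¹ ≤ 2 / M := by
      rw [inv_eq_one_div, div_le_div_iff₀ (by linarith) hpos]
      linarith
    have h3 : 0 < (M + K - 1 / 2)⁻¹ := inv_pos.2 h1
    have h4 : (4 : ℝ) / M = 2 * (2 / M) := by ring
    simp only [Nat.cast_zero, add_zero]
    linarith
  have hrange' : ∀ K : ℕ, ∑ k ∈ Finset.range K, (M ^ 2 + ((-(k + 1) : ℤ) : ℝ) ^ 2)⁻¹ ≤ 4 / M := by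
    intro K
    refine (Finset.sum_le_sum fun k _ => ?_).trans (hrange K)
    have hk : (0 : ℝ) ≤ k := k.cast_nonneg
    refine inv_anti₀ (by positivity) ?_
    push_cast
    nlinarith
  have hs1 := summable_of_sum_range_le (f := fun k : ℕ => (M ^ 2 + ((k : ℤ) : ℝ) ^ 2)⁻¹)
    (fun k => by positivity) (c := 4 / M) (by simpa using hrange)
  have hs2 := summable_of_sum_range_le (fun k => by positivity) hrange'
  have h := HasSum.of_nat_of_neg_add_one (f := fun n : ℤ => (M ^ 2 + (n : ℝ) ^ 2)⁻¹)
    hs1.hasSum hs2.hasSum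
  refine (sum_le_hasSum s (fun n _ => by positivity) h).trans ?_
  have h1 := Real.tsum_le_of_sum_range_le (f := fun k : ℕ => (M ^ 2 + ((k : ℤ) : ℝ) ^ 2)⁻¹)
    (fun k => by positivity) (c := 4 / M) (by simpa using hrange)
  have h2 := Real.tsum_le_of_sum_range_le (fun k => by positivity) hrange'
  have h3 : (8 : ℝ) / M = 4 / M + 4 / M := by ring
  rw [h3]
  exact add_le_add h1 h2

/-- The Fourier coefficients of the even periodic function `θ ↦ 𝓕 G (cos θ - 1)`, which is
`F (1 - cos θ)` for `F = 𝓕⁻ G`. -/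
noncomputable def cosineCoeff (G : ℝ → ℂ) (n : ℤ) : ℂ :=
  fourierCoeffOn Real.two_pi_pos (fun θ => 𝓕 G (Real.cos θ - 1)) n

theorem norm_cosineCoeff_le {G : ℝ → ℂ} (n : ℤ) : ‖cosineCoeff G n‖ ≤ ∫ ξ, ‖G ξ‖ := by
  rw [cosineCoeff, fourierCoeffOn_eq_integral, norm_smul, sub_zero]
  have h : ‖∫ θ in (0)..(2 * Real.pi), fourier (-n) (θ : AddCircle (2 * Real.pi - 0)) •
      𝓕 G (Real.cos θ - 1)‖ ≤ (∫ ξ, ‖G ξ‖) * |2 * Real.pi - 0| := by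
    refine intervalIntegral.norm_integral_le_of_norm_le_const fun θ _ => ?_
    rw [norm_smul, fourier_apply, Circle.norm_coe, one_mul]
    exact norm_fourier_le G _
  rw [sub_zero, abs_of_pos Real.two_pi_pos] at h
  rw [Real.norm_of_nonneg (by positivity), one_div, inv_mul_le_iff₀ Real.two_pi_pos,
    mul_comm (2 * Real.pi)]
  simpa using h

theorem cosineCoeff_add {G₁ G₂ : ℝ → ℂ} (h₁ : Integrable G₁) (h₂ : Integrable G₂) (n : ℤ) :
    cosineCoeff (G₁ + G₂) n = cosineCoeff G₁ n + cosineCoeff G₂ n := by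
  have hadd : ∀ x, 𝓕 (G₁ + G₂) x = 𝓕 G₁ x + 𝓕 G₂ x := fun x =>
    congrFun (VectorFourier.fourierIntegral_add Real.continuous_fourierChar
      (L := innerₗ ℝ) continuous_inner h₁ h₂) x
  have hc : ∀ {G : ℝ → ℂ}, Integrable G → IntervalIntegrable (fun θ : ℝ =>
      fourier (-n) (θ : AddCircle (2 * Real.pi - 0)) • 𝓕 G (Real.cos θ - 1)) volume
        0 (2 * Real.pi) := by
    intro G hG
    have := continuous_fourier_of_integrable hG
    refine Continuous.intervalIntegrable ?_ _ _
    exact ((map_continuous (fourier (-n))).comp (AddCircle.continuous_mk' _)).smul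
      (this.comp (by fun_prop))
  simp only [cosineCoeff, fourierCoeffOn_eq_integral, hadd, smul_add]
  rw [intervalIntegral.integral_add (hc h₁) (hc h₂), smul_add]

/-- The key estimate: for `g` supported in `[-N, N]` the two bounds
`∑ n ^ 2 |a n| ^ 2 ≤ (2 π N) ^ 2 ‖g‖ ^ 2` and `∑ n ^ 4 |a n| ^ 2 ≤ 2 (2 π N) ^ 4 ‖g‖ ^ 2` for the
coefficients `a n` of `𝓕 g (cos θ - 1)` give `∑ (1 + |n|) |a n| ≲ N ^ (3 / 2) ‖g‖`. -/
theorem sum_mul_norm_cosineCoeff_le_of_support {g : ℝ → ℂ} {N : ℝ} (hN : 1 ≤ N)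
    (hg : MemLp g 2 volume) (hsupp : ∀ ξ, N < |ξ| → g ξ = 0) (s : Finset ℤ) :
    ∑ n ∈ s, (1 + |(n : ℝ)|) * ‖cosineCoeff g n‖ ≤
      11 * √((2 * Real.pi * N) ^ 3 * ∫ ξ, ‖g ξ‖ ^ 2) := by
  have hN0 : 0 < N := by linarith
  have hpi := Real.pi_gt_three
  set M := 2 * Real.pi * N with hM
  set E := ∫ ξ, ‖g ξ‖ ^ 2 with hE
  have hE0 : 0 ≤ E := integral_nonneg fun ξ => by positivity
  have hM2 : 2 * N ≤ M := by rw [hM]; nlinarith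
  have hM1 : 1 ≤ M := by linarith
  -- the first two derivatives of `𝓕 g`
  set g₁ := mulFreq g with hg₁
  set g₂ := mulFreq g₁ with hg₂
  have hs1 : ∀ ξ, N < |ξ| → g₁ ξ = 0 := mulFreq_eq_zero hsupp
  have hs2 : ∀ ξ, N < |ξ| → g₂ ξ = 0 := mulFreq_eq_zero hs1
  have hL1 : MemLp g₁ 2 volume := memLp_mulFreq hg hsupp
  have hL2 : MemLp g₂ 2 volume := memLp_mulFreq hL1 hs1
  have hi0 := sq_integral_norm_le_of_support hN0 hg hsupp
  have hi1 := sq_integral_norm_le_of_support hN0 hL1 hs1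
  have hi2 := sq_integral_norm_le_of_support hN0 hL2 hs2
  have hE1 : ∫ ξ, ‖g₁ ξ‖ ^ 2 ≤ M ^ 2 * E := integral_norm_sq_mulFreq_le hg hsupp
  have hE2 : ∫ ξ, ‖g₂ ξ‖ ^ 2 ≤ M ^ 4 * E := by
    refine (integral_norm_sq_mulFreq_le hL1 hs1).trans ?_
    calc M ^ 2 * ∫ ξ, ‖g₁ ξ‖ ^ 2 ≤ M ^ 2 * (M ^ 2 * E) := by gcongr
      _ = _ := by ring
  have hP1 := integrable_and_integral_norm_sq_fourier hi1.1 hL1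
  have hP2 := integrable_and_integral_norm_sq_fourier hi2.1 hL2
  have hc0 := continuous_fourier_of_integrable hi0.1
  have hc1 := continuous_fourier_of_integrable hi1.1
  have hc2 := continuous_fourier_of_integrable hi2.1
  -- the first two derivatives of `θ ↦ 𝓕 g (cos θ - 1)`
  set u : ℝ → ℂ := fun θ => 𝓕 g (Real.cos θ - 1) with hu
  set u₁ : ℝ → ℂ := fun θ => (-Real.sin θ) • 𝓕 g₁ (Real.cos θ - 1) with hu₁
  set u₂ : ℝ → ℂ := fun θ => (-Real.sin θ) • (-Real.sin θ) • 𝓕 g₂ (Real.cos θ - 1) +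
    (-Real.cos θ) • 𝓕 g₁ (Real.cos θ - 1) with hu₂
  have hd : ∀ x : ℝ, HasDerivAt (fun θ => Real.cos θ - 1) (-Real.sin x) x := fun x =>
    (Real.hasDerivAt_cos x).sub_const 1
  have hdu : ∀ θ, HasDerivAt u (u₁ θ) θ := fun θ =>
    (hasDerivAt_fourier_mulFreq hN0 hg hsupp _).scomp θ (hd θ)
  have hdu₁ : ∀ θ, HasDerivAt u₁ (u₂ θ) θ := fun θ =>
    (Real.hasDerivAt_sin θ).neg.smul
      ((hasDerivAt_fourier_mulFreq hN0 hL1 hs1 _).scomp θ (hd θ))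
  have hcu₁ : Continuous u₁ := by fun_prop
  have hcu₂ : Continuous u₂ := by fun_prop
  have ha1 : ∀ n : ℤ, |(n : ℝ)| * ‖cosineCoeff g n‖ ≤ ‖fourierCoeffOn Real.two_pi_pos u₁ n‖ :=
    abs_mul_norm_fourierCoeffOn_le hdu hcu₁ (by simp)
  have ha2 : ∀ n : ℤ, |(n : ℝ)| ^ 2 * ‖cosineCoeff g n‖ ≤
      ‖fourierCoeffOn Real.two_pi_pos u₂ n‖ := by
    intro n
    refine le_trans ?_ (abs_mul_norm_fourierCoeffOn_le hdu₁ hcu₂ (by simp [hu₁]) n)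
    rw [pow_two, mul_assoc]
    exact mul_le_mul_of_nonneg_left (ha1 n) (abs_nonneg _)
  -- their `L²` norms
  have hI1 : (2 * Real.pi)⁻¹ * ∫ θ in (0)..(2 * Real.pi), ‖u₁ θ‖ ^ 2 ≤ M ^ 2 * E := by
    have h1 : ∫ θ in (0)..(2 * Real.pi), ‖u₁ θ‖ ^ 2 ≤
        ∫ θ in (0)..(2 * Real.pi), |Real.sin θ| * ‖𝓕 g₁ (Real.cos θ - 1)‖ ^ 2 := by
      refine intervalIntegral.integral_mono_on Real.two_pi_pos.le
        (Continuous.intervalIntegrable (by fun_prop) _ _)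
        (Continuous.intervalIntegrable (by fun_prop) _ _) fun θ _ => ?_
      rw [hu₁, norm_smul, mul_pow, norm_neg, Real.norm_eq_abs]
      gcongr
      exact pow_le_of_le_one (abs_nonneg _) (Real.abs_sin_le_one θ) two_ne_zero
    have h2 := integral_comp_cos_sub_one_le (f := fun x => ‖𝓕 g₁ x‖ ^ 2) (by fun_prop)
      (fun x => by positivity) hP1.1
    rw [inv_mul_le_iff₀ Real.two_pi_pos]
    have h3 : 0 ≤ M ^ 2 * E := by positivity
    rw [hP1.2] at h2
    nlinarith
  have hI2 : (2 * Real.pi)⁻¹ * ∫ θ in (0)..(2 * Real.pi), ‖u₂ θ‖ ^ 2 ≤ 2 * M ^ 4 * E := by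
    have hsup : ∀ x, ‖𝓕 g₁ x‖ ^ 2 ≤ M ^ 3 * E := by
      intro x
      calc ‖𝓕 g₁ x‖ ^ 2 ≤ (∫ ξ, ‖g₁ ξ‖) ^ 2 := by gcongr; exact norm_fourier_le _ _
        _ ≤ 2 * N * ∫ ξ, ‖g₁ ξ‖ ^ 2 := hi1.2
        _ ≤ M * (M ^ 2 * E) := by gcongr
        _ = _ := by ring
    have h1 : ∫ θ in (0)..(2 * Real.pi), ‖u₂ θ‖ ^ 2 ≤
        ∫ θ in (0)..(2 * Real.pi), (2 * (|Real.sin θ| * ‖𝓕 g₂ (Real.cos θ - 1)‖ ^ 2) +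
          2 * (M ^ 3 * E)) := by
      refine intervalIntegral.integral_mono_on Real.two_pi_pos.le
        (Continuous.intervalIntegrable (by fun_prop) _ _)
        (Continuous.intervalIntegrable (by fun_prop) _ _) fun θ _ => ?_
      have e1 : ‖(-Real.sin θ) • (-Real.sin θ) • 𝓕 g₂ (Real.cos θ - 1)‖ ^ 2 ≤
          |Real.sin θ| * ‖𝓕 g₂ (Real.cos θ - 1)‖ ^ 2 := by
        rw [smul_smul, norm_smul, mul_pow, neg_mul_neg, Real.norm_eq_abs, abs_mul,
          ← pow_two, ← pow_mul]
        gcongr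
        exact pow_le_of_le_one (abs_nonneg _) (Real.abs_sin_le_one θ) (by norm_num)
      have e2 : ‖(-Real.cos θ) • 𝓕 g₁ (Real.cos θ - 1)‖ ^ 2 ≤ M ^ 3 * E := by
        rw [norm_smul, mul_pow, norm_neg, Real.norm_eq_abs]
        refine (mul_le_of_le_one_left (by positivity) ?_).trans (hsup _)
        exact pow_le_one₀ (abs_nonneg _) (Real.abs_cos_le_one θ)
      refine (pow_le_pow_left₀ (norm_nonneg _) (norm_add_le _ _) 2).trans ?_
      refine (add_sq_le).trans ?_
      linarith
    rw [intervalIntegral.integral_add (Continuous.intervalIntegrable (by fun_prop) _ _)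
      (Continuous.intervalIntegrable (by fun_prop) _ _), intervalIntegral.integral_const_mul,
      intervalIntegral.integral_const, sub_zero, smul_eq_mul] at h1
    have h2 := integral_comp_cos_sub_one_le (f := fun x => ‖𝓕 g₂ x‖ ^ 2) (by fun_prop)
      (fun x => by positivity) hP2.1
    rw [hP2.2] at h2
    rw [inv_mul_le_iff₀ Real.two_pi_pos]
    have h3 : 0 ≤ M ^ 4 * E := by positivity
    -- here `2 ≤ M` absorbs the lower order term
    have h4 : 2 * (M ^ 3 * E) ≤ M ^ 4 * E := by
      have : 0 ≤ (M - 2) * (M ^ 3 * E) := mul_nonneg (by linarith) (by positivity)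
      nlinarith
    nlinarith [mul_le_mul_of_nonneg_left h4 Real.two_pi_pos.le]
  have hS1 : ∑ n ∈ s, (|(n : ℝ)| * ‖cosineCoeff g n‖) ^ 2 ≤ M ^ 2 * E :=
    ((Finset.sum_le_sum fun n _ => pow_le_pow_left₀ (by positivity) (ha1 n) 2).trans
      (sum_sq_fourierCoeffOn_le hcu₁ s)).trans hI1
  have hS2 : ∑ n ∈ s, (|(n : ℝ)| ^ 2 * ‖cosineCoeff g n‖) ^ 2 ≤ 2 * M ^ 4 * E :=
    ((Finset.sum_le_sum fun n _ => pow_le_pow_left₀ (by positivity) (ha2 n) 2).trans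
      (sum_sq_fourierCoeffOn_le hcu₂ s)).trans hI2
  -- Cauchy–Schwarz with the weight `M ^ 2 + n ^ 2`
  have hCS : (∑ n ∈ s, |(n : ℝ)| * ‖cosineCoeff g n‖) ^ 2 ≤ 24 * (M ^ 3 * E) := by
    have h1 := Finset.sum_mul_sq_le_sq_mul_sq s (fun n : ℤ => √((M ^ 2 + (n : ℝ) ^ 2)⁻¹))
      (fun n : ℤ => √(M ^ 2 + (n : ℝ) ^ 2) * (|(n : ℝ)| * ‖cosineCoeff g n‖))
    have h2 : ∀ n : ℤ, √((M ^ 2 + (n : ℝ) ^ 2)⁻¹) *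
        (√(M ^ 2 + (n : ℝ) ^ 2) * (|(n : ℝ)| * ‖cosineCoeff g n‖)) =
        |(n : ℝ)| * ‖cosineCoeff g n‖ := by
      intro n
      rw [← mul_assoc, Real.sqrt_inv, inv_mul_cancel₀ (by positivity), one_mul]
    have h3 : ∀ n : ℤ, √((M ^ 2 + (n : ℝ) ^ 2)⁻¹) ^ 2 = (M ^ 2 + (n : ℝ) ^ 2)⁻¹ := fun n =>
      Real.sq_sqrt (by positivity)
    have h4 : ∀ n : ℤ, (√(M ^ 2 + (n : ℝ) ^ 2) * (|(n : ℝ)| * ‖cosineCoeff g n‖)) ^ 2 =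
        M ^ 2 * (|(n : ℝ)| * ‖cosineCoeff g n‖) ^ 2 +
          (|(n : ℝ)| ^ 2 * ‖cosineCoeff g n‖) ^ 2 := by
      intro n
      rw [mul_pow, Real.sq_sqrt (by positivity), ← sq_abs (n : ℝ)]
      ring
    simp only [h2, h3, h4] at h1
    rw [Finset.sum_add_distrib, ← Finset.mul_sum] at h1
    refine h1.trans ?_
    calc _ ≤ 8 / M * (M ^ 2 * (M ^ 2 * E) + 2 * M ^ 4 * E) := by
          gcongr
          exact sum_inv_sq_add_sq_le hM1 s
      _ = 24 * (M ^ 3 * E) := by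
          field_simp
          ring
  set B := √(M ^ 3 * E) with hB
  have hB2 : B ^ 2 = M ^ 3 * E := Real.sq_sqrt (by positivity)
  have hB0 : 0 ≤ B := Real.sqrt_nonneg _
  have hsum : ∑ n ∈ s, |(n : ℝ)| * ‖cosineCoeff g n‖ ≤ 5 * B :=
    (abs_le_of_sq_le_sq' (by nlinarith) (by positivity)).2
  have hzero : ‖cosineCoeff g 0‖ ≤ B := by
    refine (norm_cosineCoeff_le 0).trans (abs_le_of_sq_le_sq' ?_ hB0).2
    rw [hB2]
    refine hi0.2.trans ?_
    have : M ≤ M ^ 3 := le_self_pow₀ hM1 (by norm_num)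
    gcongr
    linarith
  -- the factor `1 + |n|` is at most `2 |n|` unless `n = 0`
  have hfin : ∀ n : ℤ, (1 + |(n : ℝ)|) * ‖cosineCoeff g n‖ ≤
      2 * (|(n : ℝ)| * ‖cosineCoeff g n‖) + if n = 0 then ‖cosineCoeff g 0‖ else 0 := by
    intro n
    split_ifs with h
    · simp [h]
    · have : (1 : ℝ) ≤ |(n : ℝ)| := by exact_mod_cast Int.one_le_abs h
      nlinarith [norm_nonneg (cosineCoeff g n)]
  calc _ ≤ ∑ n ∈ s, (2 * (|(n : ℝ)| * ‖cosineCoeff g n‖) +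
        if n = 0 then ‖cosineCoeff g 0‖ else 0) := Finset.sum_le_sum fun n _ => hfin n
    _ ≤ 2 * (5 * B) + B := by
        rw [Finset.sum_add_distrib, ← Finset.mul_sum]
        gcongr
        rw [Finset.sum_ite_eq']
        split_ifs
        · exact hzero
        · exact hB0
    _ = 11 * B := by ring

/-! ### Dyadic decomposition in frequency -/

/-- The index of the dyadic annulus containing a frequency: `0` for `|ξ| < 1`, and `k ≥ 1` for
`2 ^ (k - 1) ≤ |ξ| < 2 ^ k`. -/
noncomputable def dyadicIndex (ξ : ℝ) : ℕ := Nat.size ⌊|ξ|⌋₊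

theorem measurable_dyadicIndex : Measurable dyadicIndex :=
  (Measurable.of_discrete (f := Nat.size)).comp (Nat.measurable_floor.comp measurable_norm)

theorem dyadicIndex_le_iff (ξ : ℝ) (k : ℕ) : dyadicIndex ξ ≤ k ↔ |ξ| < 2 ^ k := by
  rw [dyadicIndex, Nat.size_le, Nat.floor_lt (abs_nonneg ξ)]
  push_cast
  rfl

theorem two_rpow_dyadicIndex_le (ξ : ℝ) :
    (2 : ℝ) ^ (2 * (dyadicIndex ξ : ℝ) - 2) ≤ 1 + ξ ^ 2 := by
  rcases Nat.eq_zero_or_pos (dyadicIndex ξ) with h | h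
  · rw [h]
    have : (2 : ℝ) ^ (2 * ((0 : ℕ) : ℝ) - 2) ≤ 1 :=
      Real.rpow_le_one_of_one_le_of_nonpos (by norm_num) (by norm_num)
    nlinarith [sq_nonneg ξ]
  · obtain ⟨k, hk⟩ := Nat.exists_eq_add_of_lt h
    rw [zero_add] at hk
    have h1 : ¬ dyadicIndex ξ ≤ k := by omega
    rw [dyadicIndex_le_iff, not_lt] at h1
    have h2 : (2 : ℝ) ^ (2 * (dyadicIndex ξ : ℝ) - 2) = ((2 : ℝ) ^ k) ^ 2 := by
      rw [hk, ← pow_mul, ← Real.rpow_natCast]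
      congr 1
      push_cast
      ring
    rw [h2, ← sq_abs ξ]
    nlinarith [pow_le_pow_left₀ (by positivity) h1 2]

/-- The part of `G` with frequencies in the `k`-th dyadic annulus. -/
noncomputable def dyadicPiece (G : ℝ → ℂ) (k : ℕ) : ℝ → ℂ := {ξ | dyadicIndex ξ = k}.indicator G

theorem memLp_dyadicPiece {G : ℝ → ℂ} (hG : MemLp G 2 volume) (k : ℕ) :
    MemLp (dyadicPiece G k) 2 volume :=
  hG.indicator (measurable_dyadicIndex (MeasurableSet.singleton k))

theorem dyadicPiece_eq_zero (G : ℝ → ℂ) (k : ℕ) (ξ : ℝ) (h : (2 : ℝ) ^ k < |ξ|) :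
    dyadicPiece G k ξ = 0 := by
  refine Set.indicator_of_notMem (fun hξ => ?_) G
  have := (dyadicIndex_le_iff ξ k).1 (le_of_eq hξ)
  linarith

/-- The weight `(1 + ξ ^ 2) ^ (-s / 2)` gains a factor `2 ^ (-s k)` on the `k`-th annulus. -/
theorem integral_norm_sq_dyadicPiece_le {s : ℝ} (hs : 0 ≤ s) {G H : ℝ → ℂ} (hH : MemLp H 2 volume)
    (hG : MemLp G 2 volume) (hGH : ∀ ξ, ‖G ξ‖ ≤ (1 + ξ ^ 2) ^ (-s / 2) * ‖H ξ‖) (k : ℕ) :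
    ∫ ξ, ‖dyadicPiece G k ξ‖ ^ 2 ≤ ((2 : ℝ) ^ (s - s * k)) ^ 2 * ∫ ξ, ‖H ξ‖ ^ 2 := by
  rw [← integral_const_mul]
  refine integral_mono ((memLp_dyadicPiece hG k).integrable_norm_pow two_ne_zero)
    ((hH.integrable_norm_pow two_ne_zero).const_mul _) fun ξ => ?_
  simp only
  rw [← mul_pow]
  refine pow_le_pow_left₀ (norm_nonneg _) ?_ 2
  by_cases h : dyadicIndex ξ = k
  · rw [dyadicPiece, Set.indicator_of_mem (s := {ξ | dyadicIndex ξ = k}) h]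
    refine (hGH ξ).trans (mul_le_mul_of_nonneg_right ?_ (norm_nonneg _))
    have h1 := two_rpow_dyadicIndex_le ξ
    rw [h] at h1
    calc (1 + ξ ^ 2) ^ (-s / 2) ≤ ((2 : ℝ) ^ (2 * (k : ℝ) - 2)) ^ (-s / 2) :=
          Real.rpow_le_rpow_of_nonpos (by positivity) h1 (by linarith)
      _ = (2 : ℝ) ^ (s - s * k) := by
          rw [← Real.rpow_mul (by norm_num)]
          congr 1
          ring
  · rw [dyadicPiece, Set.indicator_of_notMem (s := {ξ | dyadicIndex ξ = k}) h, norm_zero]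
    positivity

/-- The constant in the bound of the cosine coefficients by the Sobolev norm. -/
noncomputable def cosineConstant (s : ℝ) : ℝ :=
  11 * √((2 * Real.pi) ^ 3) * 2 ^ s * (1 - 2 ^ (3 / 2 - s))⁻¹

theorem two_rpow_lt_one {s : ℝ} (hs : 3 / 2 < s) : (2 : ℝ) ^ (3 / 2 - s) < 1 :=
  Real.rpow_lt_one_of_one_lt_of_neg (by norm_num) (by linarith)

theorem cosineConstant_pos {s : ℝ} (hs : 3 / 2 < s) : 0 < cosineConstant s := by
  have h1 := sub_pos.2 (two_rpow_lt_one hs)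
  have hpi := Real.pi_pos
  unfold cosineConstant
  positivity

/-- Summing the band-limited estimate over the dyadic annuli gives a geometric series with ratio
`2 ^ (3 / 2 - s)`, which is where the condition `s > 3 / 2` enters. -/
theorem sum_mul_norm_cosineCoeff_le {s : ℝ} (hs : 3 / 2 < s) {G H : ℝ → ℂ} (hH : MemLp H 2 volume)
    (hG : MemLp G 2 volume) (hG1 : Integrable G)
    (hGH : ∀ ξ, ‖G ξ‖ ≤ (1 + ξ ^ 2) ^ (-s / 2) * ‖H ξ‖) (S : Finset ℤ) :
    ∑ n ∈ S, (1 + |(n : ℝ)|) * ‖cosineCoeff G n‖ ≤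
      cosineConstant s * √(∫ ξ, ‖H ξ‖ ^ 2) := by
  have hpi := Real.pi_pos
  set h := √(∫ ξ, ‖H ξ‖ ^ 2) with hh
  have hh0 : 0 ≤ h := Real.sqrt_nonneg _
  have hh2 : ∫ ξ, ‖H ξ‖ ^ 2 = h ^ 2 :=
    (Real.sq_sqrt (integral_nonneg fun ξ => by positivity)).symm
  set r : ℝ := 2 ^ (3 / 2 - s) with hr
  have hr0 : 0 < r := by positivity
  have hr1 : r < 1 := two_rpow_lt_one hs
  set D := 11 * √((2 * Real.pi) ^ 3) * 2 ^ s with hD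
  have hD0 : 0 < D := by positivity
  let Q : (ℝ → ℂ) → ℝ := fun g => ∑ n ∈ S, (1 + |(n : ℝ)|) * ‖cosineCoeff g n‖
  have hint : ∀ k, Integrable (dyadicPiece G k) := fun k =>
    hG1.indicator (measurable_dyadicIndex (MeasurableSet.singleton k))
  have hpiece : ∀ k, Q (dyadicPiece G k) ≤ D * h * r ^ k := by
    intro k
    refine (sum_mul_norm_cosineCoeff_le_of_support (one_le_pow₀ one_le_two (n := k))
      (memLp_dyadicPiece hG k) (dyadicPiece_eq_zero G k) S).trans ?_
    have h1 := integral_norm_sq_dyadicPiece_le (by linarith : 0 ≤ s) hH hG hGH k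
    rw [hh2] at h1
    have h2 : ((2 : ℝ) ^ k) ^ 3 * ((2 : ℝ) ^ (s - s * k)) ^ 2 = (2 ^ s * r ^ k) ^ 2 := by
      rw [hr]
      simp only [← Real.rpow_natCast, ← Real.rpow_mul two_pos.le, ← Real.rpow_add two_pos]
      congr 1
      push_cast
      ring
    have h3 : (2 * Real.pi * 2 ^ k) ^ 3 * ∫ ξ, ‖dyadicPiece G k ξ‖ ^ 2 ≤
        (2 * Real.pi) ^ 3 * (2 ^ s * r ^ k * h) ^ 2 := by
      calc _ ≤ (2 * Real.pi * 2 ^ k) ^ 3 * (((2 : ℝ) ^ (s - s * k)) ^ 2 * h ^ 2) := by gcongr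
        _ = (2 * Real.pi) ^ 3 * ((((2 : ℝ) ^ k) ^ 3 * ((2 : ℝ) ^ (s - s * k)) ^ 2) * h ^ 2) := by
            ring
        _ = _ := by
            rw [h2]
            ring
    calc _ ≤ 11 * √((2 * Real.pi) ^ 3 * (2 ^ s * r ^ k * h) ^ 2) := by gcongr
      _ = D * h * r ^ k := by
          rw [Real.sqrt_mul (by positivity), Real.sqrt_sq (by positivity), hD]
          ring
  have hQadd : ∀ {g₁ g₂ : ℝ → ℂ}, Integrable g₁ → Integrable g₂ → Q (g₁ + g₂) ≤ Q g₁ + Q g₂ := by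
    intro g₁ g₂ h₁ h₂
    simp only [Q]
    rw [← Finset.sum_add_distrib]
    refine Finset.sum_le_sum fun n _ => ?_
    rw [cosineCoeff_add h₁ h₂, ← mul_add]
    gcongr
    exact norm_add_le _ _
  have hQ1 : ∀ g : ℝ → ℂ, Q g ≤ (∑ n ∈ S, (1 + |(n : ℝ)|)) * ∫ ξ, ‖g ξ‖ := by
    intro g
    rw [Finset.sum_mul]
    exact Finset.sum_le_sum fun n _ =>
      mul_le_mul_of_nonneg_left (norm_cosineCoeff_le n) (by positivity)
  have hlow : ∀ K : ℕ, Q ({ξ | dyadicIndex ξ < K}.indicator G) ≤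
      ∑ k ∈ Finset.range K, D * h * r ^ k := by
    intro K
    induction K with
    | zero =>
      refine (hQ1 _).trans_eq ?_
      simp
    | succ K ih =>
      have h1 : {ξ | dyadicIndex ξ < K + 1}.indicator G =
          {ξ | dyadicIndex ξ < K}.indicator G + dyadicPiece G K := by
        funext ξ
        simp only [dyadicPiece, Pi.add_apply, Set.indicator_apply, Set.mem_ofPred_eq]
        rcases lt_trichotomy (dyadicIndex ξ) K with h | h | h
        · simp [h, h.ne, h.trans K.lt_succ_self]
        · simp [h]
        · simp [h.ne', h.not_gt, (Nat.succ_le_of_lt h).not_gt]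
      rw [h1, Finset.sum_range_succ]
      refine (hQadd (hG1.indicator (measurable_dyadicIndex (measurableSet_Iio (a := K))))
        (hint K)).trans ?_
      exact add_le_add ih (hpiece K)
  have hgeom : ∀ K : ℕ, ∑ k ∈ Finset.range K, D * h * r ^ k ≤ cosineConstant s * h := by
    intro K
    rw [← Finset.mul_sum]
    have h1 : ∑ k ∈ Finset.range K, r ^ k ≤ (1 - r)⁻¹ := by
      rw [← tsum_geometric_of_lt_one hr0.le hr1]
      exact (summable_geometric_of_lt_one hr0.le hr1).sum_le_tsum _ fun k _ => by positivity
    calc D * h * ∑ k ∈ Finset.range K, r ^ k ≤ D * h * (1 - r)⁻¹ := by gcongr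
      _ = cosineConstant s * h := by
          rw [cosineConstant]
          ring
  -- the remaining high frequencies are negligible in `L¹`
  have htail : Filter.Tendsto (fun K : ℕ => ∫ ξ, ‖{ξ | K ≤ dyadicIndex ξ}.indicator G ξ‖)
      Filter.atTop (nhds 0) := by
    have h1 := tendsto_integral_of_dominated_convergence (μ := (volume : Measure ℝ))
      (F := fun K : ℕ => fun ξ => ‖{ξ | K ≤ dyadicIndex ξ}.indicator G ξ‖) (f := fun _ => 0)
      (fun ξ => ‖G ξ‖) (fun K => ?_) hG1.norm (fun K => ?_) ?_
    · simpa using h1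
    · exact (hG1.indicator (measurable_dyadicIndex (measurableSet_Ici (a := K)))).norm.1
    · refine Filter.Eventually.of_forall fun ξ => ?_
      rw [norm_norm]
      exact norm_indicator_le_norm_self G ξ
    · refine Filter.Eventually.of_forall fun ξ => tendsto_const_nhds.congr' ?_
      filter_upwards [Filter.eventually_gt_atTop (dyadicIndex ξ)] with K hK
      rw [Set.indicator_of_notMem (by simpa using hK), norm_zero]
  have hall : ∀ K : ℕ, Q G ≤ cosineConstant s * h +
      (∑ n ∈ S, (1 + |(n : ℝ)|)) * ∫ ξ, ‖{ξ | K ≤ dyadicIndex ξ}.indicator G ξ‖ := by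
    intro K
    have h1 : G = {ξ | dyadicIndex ξ < K}.indicator G + {ξ | K ≤ dyadicIndex ξ}.indicator G := by
      funext ξ
      simp only [Pi.add_apply, Set.indicator_apply, Set.mem_ofPred_eq]
      rcases lt_or_ge (dyadicIndex ξ) K with h | h
      · simp [h, h.not_ge]
      · simp [h, h.not_gt]
    have h2 := hQadd (hG1.indicator (measurable_dyadicIndex (measurableSet_Iio (a := K))))
      (hG1.indicator (measurable_dyadicIndex (measurableSet_Ici (a := K))))
    have h3 : Q G ≤ Q ({ξ | dyadicIndex ξ < K}.indicator G) +
        Q ({ξ | K ≤ dyadicIndex ξ}.indicator G) := by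
      refine le_trans (le_of_eq ?_) h2
      congr 1
    exact h3.trans (add_le_add ((hlow K).trans (hgeom K)) (hQ1 _))
  have hlim := (htail.const_mul (∑ n ∈ S, (1 + |(n : ℝ)|))).const_add (cosineConstant s * h)
  rw [mul_zero, add_zero] at hlim
  exact ge_of_tendsto' hlim hall

/-! ### The cosine series -/

/-- The cosine series of `𝓕 G (cos θ - 1)` converges pointwise when its coefficients are
summable. -/
theorem hasSum_cosineCoeff {G : ℝ → ℂ} (hG : Integrable G) (hs : Summable (cosineCoeff G)) (θ : ℝ) :
    HasSum (fun n : ℤ => cosineCoeff G n * Complex.cos (n * θ)) (𝓕 G (Real.cos θ - 1)) := by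
  have hT : Fact (0 < 2 * Real.pi) := ⟨Real.two_pi_pos⟩
  let u : C(AddCircle (2 * Real.pi), ℂ) :=
    ⟨fun t => 𝓕 G (Real.Angle.cos t - 1),
      (continuous_fourier_of_integrable hG).comp
        (Real.Angle.continuous_cos.sub continuous_const)⟩
  have hu : ∀ t : ℝ, u (t : AddCircle (2 * Real.pi)) = 𝓕 G (Real.cos t - 1) := fun t => rfl
  have hcoeff : fourierCoeff u = cosineCoeff G := by
    funext n
    rw [fourierCoeff_eq_intervalIntegral u n 0, cosineCoeff, fourierCoeffOn_eq_integral, zero_add,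
      sub_zero]
    congr 1
  have hexp : ∀ t : ℝ, HasSum (fun n : ℤ => cosineCoeff G n * Complex.exp (n * t * Complex.I))
      (𝓕 G (Real.cos t - 1)) := by
    intro t
    have h := has_pointwise_sum_fourier_series_of_summable (f := u) (by rwa [hcoeff])
      (t : AddCircle (2 * Real.pi))
    rw [hcoeff, hu] at h
    have hterm : (fun n : ℤ => cosineCoeff G n * Complex.exp (n * t * Complex.I)) =
        fun n => cosineCoeff G n • fourier n (t : AddCircle (2 * Real.pi)) := by
      funext n
      rw [fourier_coe_apply, smul_eq_mul]
      congr 2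
      have hpi : (Real.pi : ℂ) ≠ 0 := by exact_mod_cast Real.pi_ne_zero
      push_cast
      field_simp
    rwa [hterm]
  -- average the Fourier series at `θ` and `-θ`
  have h := ((hexp θ).add (hexp (-θ))).div_const 2
  rw [Real.cos_neg, add_self_div_two] at h
  have hterm : (fun n : ℤ => cosineCoeff G n * Complex.cos (n * θ)) = fun n : ℤ =>
      (cosineCoeff G n * Complex.exp (n * θ * Complex.I) +
        cosineCoeff G n * Complex.exp (n * (-θ : ℝ) * Complex.I)) / 2 := by
    funext n
    rw [← mul_add, mul_div_assoc, Complex.ofReal_neg, mul_neg]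
    rfl
  rwa [hterm]

/-! ### The continuous representative of a Sobolev function -/

/-- A function in `L²_s` is the inverse Fourier transform of `(1 + ξ ^ 2) ^ (-s / 2) H` with
`H ∈ L²` of norm `‖F‖_{L²_s}`. -/
theorem exists_fourier_of_memSobolev {s : ℝ} (hs : 1 / 2 < s) (F : Lp ℂ 2 (volume : Measure ℝ))
    (hF : MemSobolev s 2 (F : 𝓢'(ℝ, ℂ))) :
    ∃ G H : ℝ → ℂ, MemLp H 2 volume ∧ MemLp G 2 volume ∧ Integrable G ∧
      (∀ ξ, ‖G ξ‖ ≤ (1 + ξ ^ 2) ^ (-s / 2) * ‖H ξ‖) ∧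
      √(∫ ξ, ‖H ξ‖ ^ 2) = sobolevNorm s (F : 𝓢'(ℝ, ℂ)) hF ∧
      𝓕⁻ G =ᵐ[volume] F := by
  set h : Lp ℂ 2 (volume : Measure ℝ) := Classical.choose hF with hh
  have hspec : besselPotential ℝ ℂ s (F : 𝓢'(ℝ, ℂ)) = h := Classical.choose_spec hF
  have hnorm : sobolevNorm s (F : 𝓢'(ℝ, ℂ)) hF = ‖h‖ := rfl
  set H : Lp ℂ 2 (volume : Measure ℝ) := 𝓕 h with hH
  set w : ℝ → ℂ := fun ξ => (((1 + ‖ξ‖ ^ 2) ^ (-s / 2) : ℝ) : ℂ) with hw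
  have hwnorm : ∀ ξ, ‖w ξ‖ = (1 + ξ ^ 2) ^ (-s / 2) := by
    intro ξ
    rw [hw, Complex.norm_real, Real.norm_of_nonneg (by positivity), Real.norm_eq_abs, sq_abs]
  have hwt : w.HasTemperateGrowth := by
    rw [hw]
    fun_prop
  have hwc : AEStronglyMeasurable w volume := hwt.1.continuous.aestronglyMeasurable
  have hwtop : MemLp w ∞ volume := by
    refine memLp_top_of_bound hwc 1 (Filter.Eventually.of_forall fun ξ => ?_)
    rw [hwnorm]
    exact Real.rpow_le_one_of_one_le_of_nonpos (by nlinarith [sq_nonneg ξ]) (by linarith)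
  have hw2 : MemLp w 2 volume := by
    rw [memLp_two_iff_integrable_sq_norm hwc]
    have := integrable_rpow_neg_one_add_norm_sq (E := ℝ) (μ := volume) (r := 2 * s)
      (by rw [Module.finrank_self]; push_cast; linarith)
    refine this.congr (Filter.Eventually.of_forall fun ξ => ?_)
    simp only
    rw [hwnorm, ← Real.rpow_natCast (_ ^ (-s / 2)), ← Real.rpow_mul (by positivity),
      Real.norm_eq_abs, sq_abs]
    congr 1
    push_cast
    ring
  -- the product of the weight and `H` represents `𝓕 F`
  set P : Lp ℂ 2 (volume : Measure ℝ) := hwtop.toLp w • H with hP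
  have hPae : P =ᵐ[volume] fun ξ => w ξ * H ξ := by
    filter_upwards [Lp.coeFn_lpSMul (r := 2) (hwtop.toLp w) H, hwtop.coeFn_toLp] with ξ h1 h2
    rw [hP, h1, Pi.smul_apply', h2, smul_eq_mul]
  have hFP : F = 𝓕⁻ P := by
    have h1 : (F : 𝓢'(ℝ, ℂ)) = besselPotential ℝ ℂ (-s) (h : 𝓢'(ℝ, ℂ)) :=
      ((besselPotential_neg_apply_eq_iff s _ _).2 hspec).symm
    have h2 : 𝓕 (F : 𝓢'(ℝ, ℂ)) = (P : 𝓢'(ℝ, ℂ)) := by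
      rw [h1, fourier_besselPotential_eq_smulLeftCLM_fourier_apply,
        Lp.fourier_toTemperedDistribution_eq, hP, Lp.toTemperedDistribution_smul_eq hwt]
    have h3 : (F : 𝓢'(ℝ, ℂ)) = ((𝓕⁻ P : Lp ℂ 2 (volume : Measure ℝ)) : 𝓢'(ℝ, ℂ)) := by
      rw [← Lp.fourierInv_toTemperedDistribution_eq, ← h2, fourierInv_fourier_eq]
    exact LinearMap.ker_eq_bot.1
      (Lp.ker_toTemperedDistributionCLM_eq_bot (F := ℂ) (μ := (volume : Measure ℝ)) (p := 2)) h3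
  have hG2 : MemLp (fun ξ => w ξ * H ξ) 2 volume := (memLp_congr_ae hPae).1 (Lp.memLp P)
  have hG1 : Integrable fun ξ => w ξ * H ξ := hw2.integrable_mul (Lp.memLp H)
  refine ⟨fun ξ => w ξ * H ξ, H, Lp.memLp H, hG2, hG1, fun ξ => ?_, ?_, ?_⟩
  · rw [norm_mul, hwnorm]
  · have h1 := congrArg RCLike.re (L2.inner_def (𝕜 := ℂ) H H)
    rw [← integral_re (L2.integrable_inner H H), inner_self_eq_norm_sq] at h1
    simp only [inner_self_eq_norm_sq] at h1
    rw [← h1, Real.sqrt_sq (norm_nonneg _), hnorm, hH, Lp.norm_fourier_eq]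
  · have h1 := coeFn_fourierInv_of_integrable P (hG1.congr hPae.symm)
    rw [← hFP] at h1
    refine Filter.EventuallyEq.trans ?_ h1.symm
    exact Filter.Eventually.of_forall fun x => Real.fourierInv_congr_ae hPae.symm x

theorem theorem1p2 (s : ℝ) (hs : 3 / 2 < s) :
    ∃ C : ℝ, 0 < C ∧
      ∀ (V : Type*) [MeasurableSpace V] [DiscreteMeasurableSpace V] (T : FlowTree V)
        (F : Lp ℂ 2 (volume : Measure ℝ)) (hF : MemSobolev s 2 (F : 𝓢'(ℝ, ℂ))),
        ∃ F₀ : ℝ → ℂ, Continuous F₀ ∧ F₀ =ᵐ[volume] F ∧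
          ∀ (p : ℝ≥0∞) [Fact (1 ≤ p)],
            ∃ A : Lp ℂ p T.measure →L[ℂ] Lp ℂ p T.measure,
              T.IsRealisation (T.functionOfLaplacian F₀) A ∧
                ‖A‖ ≤ C * sobolevNorm s (F : 𝓢'(ℝ, ℂ)) hF := by
  refine ⟨cosineConstant s, cosineConstant_pos hs, fun V _ _ T F hF => ?_⟩
  obtain ⟨G, H, hH, hG, hG1, hGH, hnorm, hGF⟩ := exists_fourier_of_memSobolev (by linarith) F hF
  have hF₀ : ∀ x, 𝓕⁻ G x = 𝓕 G (-x) := fun x => Real.fourierInv_eq_fourier_neg G x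
  refine ⟨𝓕⁻ G, ?_, hGF, fun p _ => ?_⟩
  · rw [funext hF₀]
    exact (continuous_fourier_of_integrable hG1).comp continuous_neg
  have hsum := sum_mul_norm_cosineCoeff_le hs hH hG hG1 hGH
  rw [hnorm] at hsum
  refine T.exists_isRealisation_of_cosine_series (b := cosineCoeff G)
    (mul_nonneg (cosineConstant_pos hs).le (norm_nonneg _)) hsum (fun θ => ?_) p
  rw [hF₀, neg_sub]
  exact hasSum_cosineCoeff hG1 (summable_of_sum_one_add_abs_mul_le hsum) θ
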